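/- Let $n\ge 2$, $p\ge 0$ be integers and $\tilde c\in\mathbb R$. Let $(N^{n+p},\bar g)$ be a smooth Riemannian manifold of constant sectional curvature $\tilde c$ (a real space form), and let $(M^n,g)$ be an $n$-dimensional submanifold of $N$ with the induced metric, i.e. a Riemannian manifold with a smooth isometric immersion into $N$. Let $h$ be its second fundamental form (the normal part of the Levi-Civita derivative of $N$) and $A_\xi$ its shape operators, $g(A_\xi X,Y)=\bar g(h(X,Y),\xi)$. For $x\in M$ and an $l$-dimensional subspace $L\subseteq T_xM$ ($l\ge1$) with orthonormal basis $e_1,\dots,e_l$ put $$\mathcal C(L)=\frac1l\sum_{i,j=1}^{l}|h(e_i,e_j)|^2,\qquad \mathcal C_x=\mathcal C(T_xM),$$ $$[\hat\delta_c(n-1)]_x=2\,\mathcal C_x-\frac{2n-1}{2n}\,\sup\{\mathcal C(L)\mid L\subset T_xM \text{ a hyperplane}\},$$ and let $\rho=\frac{2}{n(n-1)}\sum_{1\le i<j\le n}K(e_i\wedge e_j)$ be the normalized scalar curvature of $(M,g)$, where $e_1,\dots,e_n$ is an orthonormal basis of $T_xM$ and $K$ is the sectional curvature of $(M,g)$.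 Then at every point of $M$ $$\rho\le\hat\delta_c(n-1)+\tilde c .$$ Moreover, equality holds at a point $x\in M$ if and only if, at $x$, the following hold: (i) $M$ is invariantly quasi-umbilical: there are $p$ mutually orthogonal unit normal vectors $\xi_{n+1},\dots,\xi_{n+p}$ such that each $A_{\xi_r}$ has an eigenvalue of multiplicity at least $n-1$, with the same distinguished eigendirection for all $r$ (there is a nonzero $e\in T_xM$ that is an eigenvector of every $A_{\xi_r}$, and every $A_{\xi_r}$ is a multiple of the identity on $e^\perp$); (ii) the normal connection is trivial: the curvature tensor $R^\perp$ of the normal connection $\nabla^\perp$ vanishes; (iii) for suitable orthonormal bases $e_1,\dots,e_n$ of $T_xM$ and $e_{n+1},\dots,e_{n+p}$ of the normal space, and some $\lambda\in\mathbb R$, the shape operators $A_r=A_{e_r}$ have the matrices $$A_{n+1}=\operatorname{diag}(2\lambda,\dots,2\lambda,\lambda),\qquad A_{n+2}=\dots=A_{n+p}=0$$ (for $p=0$ conditions on the $A_r$ are void). In particular, equality holds at all points of $M$ if and only if $M$ is an invariantly quasi-umbilical submanifold with trivial normal connection whose shape operators take the form (iii) at every point. -/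

import Mathlib

open scoped Manifold ContDiff Topology

set_option maxSynthPendingDepth 3

noncomputable section

namespace Casorati

/-! ### Riemannian geometry in a coordinate domain

A metric on (an open part of) a vector space `F` is a field `G` of bilinear forms, and a
parametrized submanifold is a map `f : E → F`. Vectors of `E` double as coordinate vector
fields, which commute. -/

section Coordinates

variable {E F : Type*} [NormedAddCommGroup E] [NormedSpace ℝ E]
  [NormedAddCommGroup F] [NormedSpace ℝ F]

/-- The trilinear form `(u, v, w) ↦ T(w, u, v)`. -/
def rotate (T : F →L[ℝ] F →L[ℝ] F →L[ℝ] ℝ) : F →L[ℝ] F →L[ℝ] F →L[ℝ] ℝ :=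
  (ContinuousLinearMap.flipₗᵢ ℝ F F ℝ : (F →L[ℝ] F →L[ℝ] ℝ) →L[ℝ] (F →L[ℝ] F →L[ℝ] ℝ)) ∘L T.flip

/-- Christoffel symbols of the first kind:
`(u, v, w) ↦ (∂_u G(v, w) + ∂_v G(u, w) - ∂_w G(u, v)) / 2`. -/
def christoffelFirst (G : F → F →L[ℝ] F →L[ℝ] ℝ) (y : F) : F →L[ℝ] F →L[ℝ] F →L[ℝ] ℝ :=
  (1 / 2 : ℝ) • (fderiv ℝ G y + (fderiv ℝ G y).flip - rotate (fderiv ℝ G y))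

theorem christoffelFirst_apply (G : F → F →L[ℝ] F →L[ℝ] ℝ) (y u v w : F) :
    christoffelFirst G y u v w =
      (1 / 2) * (fderiv ℝ G y u v w + fderiv ℝ G y v u w - fderiv ℝ G y w u v) := by
  simp [christoffelFirst, rotate]

/-- Christoffel symbols `Γ(u, v)` of the Levi-Civita connection of `G` (the last index raised
with the inverse of the metric). -/
def christoffel (G : F → F →L[ℝ] F →L[ℝ] ℝ) (y : F) : F →L[ℝ] F →L[ℝ] F :=
  ContinuousLinearMap.compL ℝ F (F →L[ℝ] ℝ) F (G y).inverse ∘L christoffelFirst G y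

/-- Levi-Civita covariant derivative, in the coordinate direction `u`, of a vector field `W`
along the map `f`: `DW(u) + Γ(df u, W)`. -/
def covDerivAlong (G : F → F →L[ℝ] F →L[ℝ] ℝ) (f : E → F) (u : E) (W : E → F) (y : E) : F :=
  fderiv ℝ W y u + christoffel G (f y) (fderiv ℝ f y u) (W y)

/-- Riemann curvature `R(u, v) w = ∇_u ∇_v w - ∇_v ∇_u w` of `G`, for coordinate vector fields. -/
def riemannCoord (G : F → F →L[ℝ] F →L[ℝ] ℝ) (y u v w : F) : F :=
  covDerivAlong G id u (covDerivAlong G id v (fun _ => w)) y -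
    covDerivAlong G id v (covDerivAlong G id u (fun _ => w)) y

/-- The metric induced by `f`: `(u, v) ↦ G(df u, df v)`. -/
def inducedMetric (G : F → F →L[ℝ] F →L[ℝ] ℝ) (f : E → F) (y : E) : E →L[ℝ] E →L[ℝ] ℝ :=
  (G (f y)).bilinearComp (fderiv ℝ f y) (fderiv ℝ f y)

/-- For `w` in the ambient space, the vector `t` with `(f^*G)(t, v) = G(w, df v)` for all `v`:
then `df t` is the tangential part of `w`. -/
def tangentialPart (G : F → F →L[ℝ] F →L[ℝ] ℝ) (f : E → F) (y : E) : F →L[ℝ] E :=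
  (inducedMetric G f y).inverse ∘L
    ((ContinuousLinearMap.compL ℝ E F ℝ).flip (fderiv ℝ f y) ∘L G (f y))

/-- Orthogonal projection onto the normal space of `f` at `y`. -/
def normalPart (G : F → F →L[ℝ] F →L[ℝ] ℝ) (f : E → F) (y : E) : F →L[ℝ] F :=
  ContinuousLinearMap.id ℝ F - fderiv ℝ f y ∘L tangentialPart G f y

/-- Second fundamental form: the normal part of the ambient covariant derivative
`D²f(u, v) + Γ(df u, df v)` of the coordinate field `df v` in the direction `u`. -/
def secondFundCoord (G : F → F →L[ℝ] F →L[ℝ] ℝ) (f : E → F) (y : E) : E →L[ℝ] E →L[ℝ] F :=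
  ContinuousLinearMap.compL ℝ E F F (normalPart G f y) ∘L
    (fderiv ℝ (fderiv ℝ f) y +
      (christoffel G (f y)).bilinearComp (fderiv ℝ f y) (fderiv ℝ f y))

/-- Shape operator in the direction `ξ`: `g(A_ξ u, v) = G(h(u, v), ξ)`. -/
def shapeCoord (G : F → F →L[ℝ] F →L[ℝ] ℝ) (f : E → F) (y : E) (ξ : F) : E →L[ℝ] E :=
  (inducedMetric G f y).inverse ∘L
    (ContinuousLinearMap.compL ℝ E F ℝ ((G (f y)).flip ξ) ∘L secondFundCoord G f y)

/-- Normal connection: the normal part of the ambient covariant derivative. -/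
def normalConnCoord (G : F → F →L[ℝ] F →L[ℝ] ℝ) (f : E → F) (u : E) (ξ : E → F) (y : E) : F :=
  normalPart G f y (covDerivAlong G f u ξ y)

/-- Curvature of the normal connection, `R^⊥(u, v) ξ = ∇^⊥_u ∇^⊥_v ξ - ∇^⊥_v ∇^⊥_u ξ`, for
coordinate vector fields `u, v` and a normal field `ξ`. -/
def normalCurvCoord (G : F → F →L[ℝ] F →L[ℝ] ℝ) (f : E → F) (u v : E) (ξ : E → F) (y : E) : F :=
  normalConnCoord G f u (normalConnCoord G f v ξ) y -
    normalConnCoord G f v (normalConnCoord G f u ξ) y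

/-- The normal curvature tensor vanishes at `y`: it kills every smooth local normal field. -/
def NormalFlatCoord (G : F → F →L[ℝ] F →L[ℝ] ℝ) (f : E → F) (y : E) : Prop :=
  ∀ ξ : E → F, ContDiffAt ℝ ∞ ξ y → (∀ᶠ z in 𝓝 y, ∀ u, G (f z) (fderiv ℝ f z u) (ξ z) = 0) →
    ∀ u v, normalCurvCoord G f u v ξ y = 0

end Coordinates

/-! ### Orthonormal frames of a subspace -/

section Frames

variable {V : Type*} [AddCommGroup V] [Module ℝ V]

/-- `e` is orthonormal for the bilinear form `B`. -/
def IsOrthonormal (B : V → V → ℝ) {ι : Type*} [DecidableEq ι] (e : ι → V) : Prop :=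
  ∀ i j, B (e i) (e j) = if i = j then 1 else 0

theorem exists_orthonormal [FiniteDimensional ℝ V] (B : V →ₗ[ℝ] V →ₗ[ℝ] ℝ)
    (hs : ∀ v w, B v w = B w v) (hp : ∀ v, v ≠ 0 → 0 < B v v) (L : Submodule ℝ V) :
    ∃ e : Fin (Module.finrank ℝ L) → V,
      IsOrthonormal (fun v w => B v w) e ∧ Submodule.span ℝ (Set.range e) = L := by
  let core : InnerProductSpace.Core ℝ L :=
    { inner := fun v w => B v w
      conj_inner_symm := fun v w => by simp [hs (w : V) v]
      re_inner_nonneg := fun v => by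
        by_cases h : (v : V) = 0
        · simp [h]
        · simpa using (hp v h).le
      add_left := fun u v w => by simp
      smul_left := fun u v r => by simp
      definite := fun v h => by
        by_contra hv
        exact (hp v (by simpa using hv)).ne' h }
  let _ : NormedAddCommGroup L := core.toNormedAddCommGroup
  let _ : InnerProductSpace ℝ L := InnerProductSpace.ofCore core.toCore
  let b := stdOrthonormalBasis ℝ L
  refine ⟨fun i => (b i : V), fun i j => ?_, ?_⟩
  · exact orthonormal_iff_ite.1 b.orthonormal i j
  · have h1 : Set.range (fun i => (b i : V)) = L.subtype '' Set.range b := by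
      rw [← Set.range_comp]; rfl
    have h2 : Submodule.span ℝ (Set.range b) = ⊤ := by
      rw [← b.coe_toBasis]; exact b.toBasis.span_eq
    rw [h1, Submodule.span_image, h2, Submodule.map_top, Submodule.range_subtype]

end Frames

/-! ### Riemannian manifolds -/

section Manifolds

/-- Smooth Riemannian metrics on an `m`-dimensional manifold. -/
abbrev Metric (m : ℕ) (M : Type*) [TopologicalSpace M] [ChartedSpace (EuclideanSpace ℝ (Fin m)) M]
    [IsManifold (𝓡 m) ∞ M] :=
  Bundle.ContMDiffRiemannianMetric (𝓡 m) ∞ (EuclideanSpace ℝ (Fin m))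
    (fun x : M => TangentSpace (𝓡 m) x)

variable {m : ℕ} {M : Type*} [TopologicalSpace M] [ChartedSpace (EuclideanSpace ℝ (Fin m)) M]
  [IsManifold (𝓡 m) ∞ M]

/-- The metric `g` in the preferred chart around `x`. The tangent space `TangentSpace (𝓡 m) x` is
the model space, identified through this same chart. -/
def chartMetric (g : Metric m M) (x : M) (y : EuclideanSpace ℝ (Fin m)) :
    EuclideanSpace ℝ (Fin m) →L[ℝ] EuclideanSpace ℝ (Fin m) →L[ℝ] ℝ :=
  ContinuousLinearMap.bilinearComp
    (E := EuclideanSpace ℝ (Fin m)) (F := EuclideanSpace ℝ (Fin m))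
    (g.inner ((extChartAt (𝓡 m) x).symm y))
    (mfderiv (𝓡 m) (𝓡 m) (extChartAt (𝓡 m) x).symm y)
    (mfderiv (𝓡 m) (𝓡 m) (extChartAt (𝓡 m) x).symm y)

theorem chartMetric_apply (g : Metric m M) (x : M) (y u v : EuclideanSpace ℝ (Fin m)) :
    chartMetric g x y u v = g.inner ((extChartAt (𝓡 m) x).symm y)
      (mfderiv (𝓡 m) (𝓡 m) (extChartAt (𝓡 m) x).symm y u)
      (mfderiv (𝓡 m) (𝓡 m) (extChartAt (𝓡 m) x).symm y v) := rfl

/-- Riemann curvature tensor of `(M, g)` at `x`, computed in the preferred chart around `x`. -/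
def riemann (g : Metric m M) (x : M) (u v w : TangentSpace (𝓡 m) x) : TangentSpace (𝓡 m) x :=
  riemannCoord (F := EuclideanSpace ℝ (Fin m)) (chartMetric g x) (extChartAt (𝓡 m) x x) u v w

/-- Sectional curvature of the plane spanned by `u` and `v`. -/
def sectionalCurvature (g : Metric m M) (x : M) (u v : TangentSpace (𝓡 m) x) : ℝ :=
  g.inner x (riemann g x u v v) u /
    (g.inner x u u * g.inner x v v - g.inner x u v ^ 2)

/-- `(M, g)` is a real space form of constant sectional curvature `c`. -/
def IsRealSpaceForm (g : Metric m M) (c : ℝ) : Prop :=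
  ∀ (x : M) (u v : TangentSpace (𝓡 m) x), LinearIndependent ℝ ![u, v] →
    sectionalCurvature g x u v = c

/-- Subspaces of the tangent space have orthonormal bases. -/
theorem exists_frame (g : Metric m M) (x : M) (L : Submodule ℝ (TangentSpace (𝓡 m) x)) :
    ∃ e : Fin (Module.finrank ℝ L) → TangentSpace (𝓡 m) x,
      IsOrthonormal (fun v w => g.inner x v w) e ∧ Submodule.span ℝ (Set.range e) = L := by
  have : FiniteDimensional ℝ (TangentSpace (𝓡 m) x) :=
    inferInstanceAs (FiniteDimensional ℝ (EuclideanSpace ℝ (Fin m)))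
  exact exists_orthonormal
    (LinearMap.mk₂ ℝ (fun v w => g.inner x v w) (by simp) (by simp) (by simp) (by simp))
    (fun v w => g.symm x v w) (fun v hv => g.pos x v hv) L

/-- Some orthonormal basis of `L`; the quantities defined with it do not depend on the choice. -/
def frame (g : Metric m M) (x : M) (L : Submodule ℝ (TangentSpace (𝓡 m) x)) :
    Fin (Module.finrank ℝ L) → TangentSpace (𝓡 m) x :=
  (exists_frame g x L).choose

/-- Scalar curvature `τ = ∑_{i < j} K(e_i ∧ e_j)`. -/
def scalarCurvature (g : Metric m M) (x : M) : ℝ :=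
  ∑ i, ∑ j, if i < j then sectionalCurvature g x (frame g x ⊤ i) (frame g x ⊤ j) else 0

/-- Normalized scalar curvature `ρ = 2 τ / (n (n - 1))`. -/
def normalizedScalarCurvature (g : Metric m M) (x : M) : ℝ :=
  2 * scalarCurvature g x / ((m : ℝ) * (m - 1))

end Manifolds

/-! ### Submanifolds -/

section Submanifolds

variable {n d : ℕ}
  {M : Type*} [TopologicalSpace M] [ChartedSpace (EuclideanSpace ℝ (Fin n)) M]
  [IsManifold (𝓡 n) ∞ M]
  {N : Type*} [TopologicalSpace N] [ChartedSpace (EuclideanSpace ℝ (Fin d)) N]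
  [IsManifold (𝓡 d) ∞ N]

/-- `φ` is a smooth isometric immersion, i.e. `M` is a submanifold of `N` with the induced
metric (positivity of `g` makes the differential injective). -/
structure IsIsometricImmersion (g : Metric n M) (gN : Metric d N) (φ : M → N) : Prop where
  contMDiff : ContMDiff (𝓡 n) (𝓡 d) ∞ φ
  isometric : ∀ (x : M) (u v : TangentSpace (𝓡 n) x),
    gN.inner (φ x) (mfderiv (𝓡 n) (𝓡 d) φ x u) (mfderiv (𝓡 n) (𝓡 d) φ x v) = g.inner x u v

/-- Second fundamental form of `φ` at `x`, computed in the preferred charts around `x`, `φ x`. -/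
def secondFund (gN : Metric d N) (φ : M → N) (x : M) (u v : TangentSpace (𝓡 n) x) :
    TangentSpace (𝓡 d) (φ x) :=
  secondFundCoord (chartMetric gN (φ x)) (writtenInExtChartAt (𝓡 n) (𝓡 d) x φ)
    (extChartAt (𝓡 n) x x) u v

/-- Shape operator `A_ξ` of `φ` at `x`. -/
def shapeOperator (gN : Metric d N) (φ : M → N) (x : M) (ξ : TangentSpace (𝓡 d) (φ x))
    (u : TangentSpace (𝓡 n) x) : TangentSpace (𝓡 n) x :=
  shapeCoord (chartMetric gN (φ x)) (writtenInExtChartAt (𝓡 n) (𝓡 d) x φ)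
    (extChartAt (𝓡 n) x x) ξ u

/-- The normal curvature tensor of `φ` vanishes at `x`. -/
def NormalFlatAt (gN : Metric d N) (φ : M → N) (x : M) : Prop :=
  NormalFlatCoord (chartMetric gN (φ x)) (writtenInExtChartAt (𝓡 n) (𝓡 d) x φ)
    (extChartAt (𝓡 n) x x)

/-- The normal connection of `φ` is trivial: its curvature tensor vanishes. -/
def TrivialNormalConnection (gN : Metric d N) (φ : M → N) : Prop :=
  ∀ x : M, NormalFlatAt (n := n) gN φ x

/-- Casorati curvature of the subspace `L` of the tangent space at `x`:
`C(L) = (1 / dim L) ∑_{i, j} |h(e_i, e_j)|²`. -/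
def casoratiOn (g : Metric n M) (gN : Metric d N) (φ : M → N) (x : M)
    (L : Submodule ℝ (TangentSpace (𝓡 n) x)) : ℝ :=
  (1 / (Module.finrank ℝ L : ℝ)) * ∑ i, ∑ j,
    gN.inner (φ x) (secondFund gN φ x (frame g x L i) (frame g x L j))
      (secondFund gN φ x (frame g x L i) (frame g x L j))

/-- Casorati curvature of the submanifold at `x`. -/
def casorati (g : Metric n M) (gN : Metric d N) (φ : M → N) (x : M) : ℝ :=
  casoratiOn g gN φ x ⊤

/-- Normalized Casorati curvature
`2 C - ((2 n - 1) / (2 n)) sup {C(L) | L a hyperplane of T_x M}`. -/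
def deltaHat (g : Metric n M) (gN : Metric d N) (φ : M → N) (x : M) : ℝ :=
  2 * casorati g gN φ x - ((2 * n - 1) / (2 * n) : ℝ) *
    sSup {C : ℝ | ∃ L : Submodule ℝ (TangentSpace (𝓡 n) x),
      Module.finrank ℝ L + 1 = n ∧ C = casoratiOn g gN φ x L}

/-- `ξ` is an orthonormal family of vectors normal to the submanifold at `x`. -/
def IsNormalFrame (gN : Metric d N) (φ : M → N) (x : M) {p : ℕ}
    (ξ : Fin p → TangentSpace (𝓡 d) (φ x)) : Prop :=
  IsOrthonormal (fun v w => gN.inner (φ x) v w) ξ ∧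
    ∀ (r : Fin p) (u : TangentSpace (𝓡 n) x),
      gN.inner (φ x) (mfderiv (𝓡 n) (𝓡 d) φ x u) (ξ r) = 0

/-- Invariantly quasi-umbilical at `x` (codimension `p`): for some `p` orthonormal normal vectors,
each shape operator has an eigenvalue `a` of multiplicity at least `n - 1`, whose eigenspace
contains the orthogonal complement of a common eigendirection `e`. -/
def InvariantlyQuasiUmbilicalAt (p : ℕ) (g : Metric n M) (gN : Metric d N) (φ : M → N)
    (x : M) : Prop :=
  ∃ ξ : Fin p → TangentSpace (𝓡 d) (φ x), IsNormalFrame (n := n) gN φ x ξ ∧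
    ∃ e : TangentSpace (𝓡 n) x, e ≠ 0 ∧ ∀ r, ∃ a b : ℝ,
      shapeOperator gN φ x (ξ r) e = b • e ∧
      ∀ v : TangentSpace (𝓡 n) x, g.inner x v e = 0 → shapeOperator gN φ x (ξ r) v = a • v

/-- Invariantly quasi-umbilical submanifolds. -/
def InvariantlyQuasiUmbilical (p : ℕ) (g : Metric n M) (gN : Metric d N) (φ : M → N) : Prop :=
  ∀ x : M, InvariantlyQuasiUmbilicalAt p g gN φ x

/-- The matrix of the shape operator `A_ξ` in the orthonormal frame `e`. -/
def shapeMatrix (g : Metric n M) (gN : Metric d N) (φ : M → N) (x : M)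
    (e : Fin n → TangentSpace (𝓡 n) x) (ξ : TangentSpace (𝓡 d) (φ x)) :
    Matrix (Fin n) (Fin n) ℝ :=
  Matrix.of fun i j => g.inner x (shapeOperator gN φ x ξ (e j)) (e i)

/-- In suitable orthonormal tangent and normal frames at `x`, the first shape operator is
`diag(2λ, …, 2λ, λ)` and the others vanish. -/
def IdealShapeAt (p : ℕ) (g : Metric n M) (gN : Metric d N) (φ : M → N) (x : M) : Prop :=
  ∃ (e : Fin n → TangentSpace (𝓡 n) x) (ξ : Fin p → TangentSpace (𝓡 d) (φ x)) (lam : ℝ),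
    IsOrthonormal (fun v w => g.inner x v w) e ∧ IsNormalFrame (n := n) gN φ x ξ ∧
    ∀ r : Fin p, shapeMatrix g gN φ x e (ξ r) =
      if (r : ℕ) = 0 then
        Matrix.diagonal (fun i : Fin n => if (i : ℕ) + 1 = n then lam else 2 * lam)
      else 0

end Submanifolds

end Casorati

end

/-!
In a chart the Gauss equation and constant ambient curvature `c` give
`n (n - 1) (ρ - c) = |tr h|² - |h|²`. If the hyperplane `L` maximizes `C(L)`, then likewise
`n (n - 1) δ̂ = (2n - 1) (|h|² - |h|_L|² / 2) - |h|²`, so the gap `δ̂ + c - ρ` is, up to the factor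
`n (n - 1)`, equal to `(2n - 1) (|h|² - |h|_L|² / 2) - |tr h|²`. Let `ν` be a unit normal of `L` in
the tangent space and `η = tr h / (2n - 1)`. The form `(u, v) ↦ (2⟪u, v⟫ - ⟪u, ν⟫⟪v, ν⟫) η` has the
same trace as `h`, and it is the orthogonal projection of `h`, for the quadratic form
`|h|² - |h|_L|² / 2`, onto the forms of this shape. Pythagoras identifies the gap with `2n - 1`
times the weighted square norm of the remainder, which is nonnegative and vanishes exactly when `h`
itself has this shape. Then every shape operator is `diag(2λ, …, 2λ, λ)` in a common frame, all
of them commute, and the Ricci equation makes the normal connection flat.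
-/

noncomputable section

namespace Casorati

section CurvatureLike

open scoped RealInnerProductSpace

/-- A tensor `T(u, v, w, z)` with the algebraic symmetries of `⟪R(u, v) w, z⟫`. Linearity is only
required in the first argument: the symmetries carry it over to the others. -/
structure IsCurvatureLike {V : Type*} [AddCommGroup V] [Module ℝ V] (T : V → V → V → V → ℝ) :
    Prop where
  add_left : ∀ u u' v w z, T (u + u') v w z = T u v w z + T u' v w z
  smul_left : ∀ (r : ℝ) (u v w z), T (r • u) v w z = r * T u v w z
  swap_left : ∀ u v w z, T u v w z = -T v u w z
  swap_right : ∀ u v w z, T u v w z = -T u v z w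
  bianchi : ∀ u v w z, T u v w z + T v w u z + T w u v z = 0

namespace IsCurvatureLike

variable {V : Type*} [AddCommGroup V] [Module ℝ V] {T T' : V → V → V → V → ℝ}

theorem sub (hT : IsCurvatureLike T) (hT' : IsCurvatureLike T') : IsCurvatureLike (T - T') where
  add_left u u' v w z := by
    simp only [Pi.sub_apply, hT.add_left, hT'.add_left]; ring
  smul_left r u v w z := by
    simp only [Pi.sub_apply, hT.smul_left, hT'.smul_left]; ring
  swap_left u v w z := by
    simp only [Pi.sub_apply, hT.swap_left u, hT'.swap_left u]; ring
  swap_right u v w z := by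
    simp only [Pi.sub_apply, hT.swap_right u v w, hT'.swap_right u v w]; ring
  bianchi u v w z := by
    have := hT.bianchi u v w z
    have := hT'.bianchi u v w z
    simp only [Pi.sub_apply]; linarith

theorem pair_symm (hT : IsCurvatureLike T) (u v w z : V) : T u v w z = T w z u v := by
  linarith [hT.bianchi u v w z, hT.bianchi v w z u, hT.bianchi w z u v, hT.bianchi z u v w,
    hT.swap_right u v z w, hT.swap_right v w u z, hT.swap_right w z u v, hT.swap_right z u v w,
    hT.swap_left u w z v, hT.swap_right w u z v, hT.swap_left v z u w, hT.swap_right z v u w]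

theorem add_right (hT : IsCurvatureLike T) (u v w z z' : V) :
    T u v w (z + z') = T u v w z + T u v w z' := by
  have hflip : ∀ x, T u v w x = T x w v u := fun x => by
    rw [hT.pair_symm, hT.swap_left, hT.swap_right, neg_neg]
  rw [hflip, hflip, hflip, hT.add_left]

theorem sectional_eq_zero_of_not_linearIndependent (hT : IsCurvatureLike T) {u v : V}
    (huv : ¬LinearIndependent ℝ ![u, v]) : T u v v u = 0 := by
  by_cases hu : u = 0
  · simpa [hu] using hT.smul_left 0 0 v v 0
  · obtain ⟨r, rfl⟩ : ∃ r : ℝ, r • u = v := by simpa [LinearIndependent.pair_iff' hu] using huv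
    have huu : T u u (r • u) u = 0 := self_eq_neg.1 (hT.swap_left u u (r • u) u)
    rw [hT.swap_left, hT.smul_left, huu, mul_zero, neg_zero]

theorem eq_zero_of_sectional_eq_zero (hT : IsCurvatureLike T)
    (h0 : ∀ u v, LinearIndependent ℝ ![u, v] → T u v v u = 0) (u v w z : V) : T u v w z = 0 := by
  have hsec : ∀ u v, T u v v u = 0 := fun u v =>
    (em (LinearIndependent ℝ ![u, v])).elim (h0 u v) hT.sectional_eq_zero_of_not_linearIndependent
  have hpol : ∀ u v w, T u v w u = 0 := by
    intro u v w
    have hvw := hsec (v + w) u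
    rw [hT.add_left, hT.add_right, hT.add_right, hsec, hsec] at hvw
    linarith [hT.pair_symm w u u v, hT.swap_left u v w u, hT.swap_right v u u w]
  have hskew : ∀ u v w z, T u v w z = -T z v w u := by
    intro u v w z
    have huz := hpol (u + z) v w
    rw [hT.add_left, hT.add_right, hT.add_right, hpol, hpol] at huz
    linarith
  have hskew' : ∀ u v w z, T u v w z = -T w v u z := fun u v w z => by
    rw [hskew, hT.swap_right, hskew w]
  -- `T` is now alternating, so its three terms in the Bianchi identity are equal.
  linarith [hT.bianchi u v w z, hT.swap_left v w u z, hskew' w v u z, hskew' w u v z,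
    hT.swap_left v u w z]

end IsCurvatureLike

variable {V : Type*} [NormedAddCommGroup V] [InnerProductSpace ℝ V]

theorem isCurvatureLike_constant (c : ℝ) :
    IsCurvatureLike fun u v w z : V => c * (⟪v, w⟫ * ⟪u, z⟫ - ⟪u, w⟫ * ⟪v, z⟫) where
  add_left _ _ _ _ _ := by simp only [inner_add_left]; ring
  smul_left _ _ _ _ _ := by simp only [real_inner_smul_left]; ring
  swap_left _ _ _ _ := by ring
  swap_right _ _ _ _ := by ring
  bianchi u v w _ := by
    rw [real_inner_comm u v, real_inner_comm v w, real_inner_comm w u]; ring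

theorem gram_ne_zero_of_linearIndependent {u v : V} (huv : LinearIndependent ℝ ![u, v]) :
    ⟪u, u⟫ * ⟪v, v⟫ - ⟪u, v⟫ ^ 2 ≠ 0 := by
  have h := (LinearMap.BilinForm.apply_sq_lt_iff_linearIndependent_of_symm (innerₗ V)
    (fun _ => real_inner_self_pos.2) isSymm_inner u v).2 huv
  exact sub_ne_zero.2 h.ne'

theorem IsCurvatureLike.eq_of_sectional_eq {T : V → V → V → V → ℝ} (hT : IsCurvatureLike T) {c : ℝ}
    (hc : ∀ u v, LinearIndependent ℝ ![u, v] →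
      T u v v u / (⟪u, u⟫ * ⟪v, v⟫ - ⟪u, v⟫ ^ 2) = c) (u v w z : V) :
    T u v w z = c * (⟪v, w⟫ * ⟪u, z⟫ - ⟪u, w⟫ * ⟪v, z⟫) := by
  refine sub_eq_zero.1 ((hT.sub (isCurvatureLike_constant c)).eq_zero_of_sectional_eq_zero
    (fun u v huv => ?_) u v w z)
  rw [Pi.sub_apply, Pi.sub_apply, Pi.sub_apply, Pi.sub_apply,
    (div_eq_iff (gram_ne_zero_of_linearIndependent huv)).1 (hc u v huv), real_inner_comm u v]
  ring

end CurvatureLike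

section Coordinates

variable {E F : Type*} [NormedAddCommGroup E] [NormedSpace ℝ E]
  [NormedAddCommGroup F] [NormedSpace ℝ F]

theorem fderiv_clm_apply_const {X : Type*} [NormedAddCommGroup X] [NormedSpace ℝ X]
    {c : E → F →L[ℝ] X} {y : E} (hc : DifferentiableAt ℝ c y) (u : E) (v : F) :
    fderiv ℝ (fun z => c z v) y u = fderiv ℝ c y u v := by
  simp [fderiv_clm_apply hc (differentiableAt_const v)]

theorem isInvertible_of_pos [FiniteDimensional ℝ F] {B : F →L[ℝ] F →L[ℝ] ℝ}
    (hB : ∀ u, u ≠ 0 → 0 < B u u) : B.IsInvertible := by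
  have hinj : Function.Injective (B : F →ₗ[ℝ] F →L[ℝ] ℝ) :=
    (injective_iff_map_eq_zero _).2 fun u hu => by
      by_contra hne
      exact (hB u hne).ne' (congrArg (fun α : F →L[ℝ] ℝ => α u) hu)
  have hd : Module.finrank ℝ F = Module.finrank ℝ (F →L[ℝ] ℝ) := by
    rw [← (LinearMap.toContinuousLinearMap : (F →ₗ[ℝ] ℝ) ≃ₗ[ℝ] F →L[ℝ] ℝ).finrank_eq]
    exact (Subspace.dual_finrank_eq (K := ℝ) (V := F)).symm
  exact ⟨(LinearEquiv.ofInjectiveOfFinrankEq _ hinj hd).toContinuousLinearEquiv, rfl⟩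

theorem riemannCoord_swap (G : F → F →L[ℝ] F →L[ℝ] ℝ) (y u v w : F) :
    riemannCoord G y u v w = -riemannCoord G y v u w :=
  (neg_sub _ _).symm

/-- `G` is a `C²` field of bilinear forms near `y`, symmetric and positive definite there: a
Riemannian metric on a neighbourhood of `y`. -/
structure IsMetricNear (G : F → F →L[ℝ] F →L[ℝ] ℝ) (y : F) : Prop where
  contDiffAt : ContDiffAt ℝ 2 G y
  eventually_symm : ∀ᶠ z in 𝓝 y, ∀ u v, G z u v = G z v u
  eventually_pos : ∀ᶠ z in 𝓝 y, ∀ u, u ≠ 0 → 0 < G z u u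

namespace IsMetricNear

variable {G : F → F →L[ℝ] F →L[ℝ] ℝ} {y : F}

protected theorem eventually (h : IsMetricNear G y) : ∀ᶠ z in 𝓝 y, IsMetricNear G z := by
  filter_upwards [h.contDiffAt.eventually (by simp), h.eventually_symm.eventually_nhds,
    h.eventually_pos.eventually_nhds] with z hC hs hp
  exact ⟨hC, hs, hp⟩

theorem symm (h : IsMetricNear G y) (u v : F) : G y u v = G y v u :=
  h.eventually_symm.self_of_nhds u v

theorem differentiableAt (h : IsMetricNear G y) : DifferentiableAt ℝ G y :=
  h.contDiffAt.differentiableAt (by simp)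

theorem fderiv_symm (h : IsMetricNear G y) (u v w : F) :
    fderiv ℝ G y u v w = fderiv ℝ G y u w v := by
  have happly : ∀ v w, fderiv ℝ (fun z => G z v w) y u = fderiv ℝ G y u v w := fun v w => by
    rw [fderiv_clm_apply_const (h.differentiableAt.clm_apply (differentiableAt_const v)),
      fderiv_clm_apply_const h.differentiableAt]
  have hsymm : (fun z => G z v w) =ᶠ[𝓝 y] fun z => G z w v :=
    h.eventually_symm.mono fun z hz => hz v w
  rw [← happly, hsymm.fderiv_eq, happly]

variable [FiniteDimensional ℝ F]

theorem isInvertible (h : IsMetricNear G y) : (G y).IsInvertible :=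
  isInvertible_of_pos h.eventually_pos.self_of_nhds

theorem ext_inner_left (h : IsMetricNear G y) {a b : F} (hab : ∀ w, G y a w = G y b w) : a = b :=
  h.isInvertible.injective (ContinuousLinearMap.ext hab)

theorem inner_christoffel (h : IsMetricNear G y) (u v w : F) :
    G y (christoffel G y u v) w = christoffelFirst G y u v w :=
  congrArg (fun α : F →L[ℝ] ℝ => α w)
    (h.isInvertible.self_apply_inverse (christoffelFirst G y u v))

theorem christoffel_symm (h : IsMetricNear G y) (u v : F) :
    christoffel G y u v = christoffel G y v u := by
  refine h.ext_inner_left fun w => ?_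
  rw [h.inner_christoffel, h.inner_christoffel, christoffelFirst_apply, christoffelFirst_apply,
    h.fderiv_symm w u v]
  ring

theorem fderiv_eq (h : IsMetricNear G y) (u v w : F) :
    fderiv ℝ G y u v w = G y (christoffel G y u v) w + G y v (christoffel G y u w) := by
  rw [h.symm v, h.inner_christoffel, h.inner_christoffel, christoffelFirst_apply,
    christoffelFirst_apply, h.fderiv_symm u w v, h.fderiv_symm w u v, h.fderiv_symm v u w]
  ring

theorem contDiffAt_christoffel (h : IsMetricNear G y) : ContDiffAt ℝ 1 (christoffel G) y := by
  have hD : ContDiffAt ℝ 1 (fderiv ℝ G) y := h.contDiffAt.fderiv_right (by norm_num)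
  have hinv : ContDiffAt ℝ 1 (fun z => (G z).inverse) y :=
    h.isInvertible.contDiffAt_map_inverse.comp y (h.contDiffAt.of_le (by norm_num))
  have hflip := (ContinuousLinearMap.flipₗᵢ ℝ F F (F →L[ℝ] ℝ)).contDiff.contDiffAt.comp y hD
  have hfirst : ContDiffAt ℝ 1 (christoffelFirst G) y :=
    ((hD.add hflip).sub (contDiffAt_const.clm_comp hflip)).const_smul (1 / 2 : ℝ)
  exact ((ContinuousLinearMap.compL ℝ F (F →L[ℝ] ℝ) F).contDiff.contDiffAt.comp y hinv).clm_comp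
    hfirst

theorem differentiableAt_christoffel (h : IsMetricNear G y) :
    DifferentiableAt ℝ (christoffel G) y :=
  h.contDiffAt_christoffel.differentiableAt (by simp)

theorem fderiv_christoffel_symm (h : IsMetricNear G y) (u v w : F) :
    fderiv ℝ (christoffel G) y u v w = fderiv ℝ (christoffel G) y u w v := by
  have hΓ := h.differentiableAt_christoffel
  have happly : ∀ v w, fderiv ℝ (fun z => christoffel G z v w) y u =
      fderiv ℝ (christoffel G) y u v w := fun v w => by
    rw [fderiv_clm_apply_const (hΓ.clm_apply (differentiableAt_const v)),
      fderiv_clm_apply_const hΓ]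
  have hsymm : (fun z => christoffel G z v w) =ᶠ[𝓝 y] fun z => christoffel G z w v :=
    h.eventually.mono fun z hz => hz.christoffel_symm v w
  rw [← happly, hsymm.fderiv_eq, happly]

end IsMetricNear

section CovariantDerivative

variable {G : F → F →L[ℝ] F →L[ℝ] ℝ} {f V W : E → F} {y : E}

theorem covDerivAlong_apply (G : F → F →L[ℝ] F →L[ℝ] ℝ) (f : E → F) (u : E) (W : E → F) (y : E) :
    covDerivAlong G f u W y = fderiv ℝ W y u + christoffel G (f y) (fderiv ℝ f y u) (W y) := rfl

theorem differentiableAt_fderiv_of_contDiffAt (hf : ContDiffAt ℝ 2 f y) :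
    DifferentiableAt ℝ (fderiv ℝ f) y :=
  (hf.fderiv_right (m := 1) (by norm_num)).differentiableAt (by simp)

theorem differentiableAt_covDerivAlong (hΓ : DifferentiableAt ℝ (christoffel G) (f y))
    (hf : ContDiffAt ℝ 2 f y) (hW : ContDiffAt ℝ 2 W y) (v : E) :
    DifferentiableAt ℝ (covDerivAlong G f v W) y := by
  have hf₀ : DifferentiableAt ℝ f y := hf.differentiableAt (by simp)
  have hW₀ : DifferentiableAt ℝ W y := hW.differentiableAt (by simp)
  have hf₁ := differentiableAt_fderiv_of_contDiffAt hf
  have hW₁ := differentiableAt_fderiv_of_contDiffAt hW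
  unfold covDerivAlong
  fun_prop

theorem fderiv_covDerivAlong (hΓ : DifferentiableAt ℝ (christoffel G) (f y))
    (hf : ContDiffAt ℝ 2 f y) (hW : ContDiffAt ℝ 2 W y) (u v : E) :
    fderiv ℝ (covDerivAlong G f v W) y u = fderiv ℝ (fderiv ℝ W) y u v +
      (fderiv ℝ (christoffel G) (f y) (fderiv ℝ f y u) (fderiv ℝ f y v) (W y) +
        christoffel G (f y) (fderiv ℝ (fderiv ℝ f) y u v) (W y) +
        christoffel G (f y) (fderiv ℝ f y v) (fderiv ℝ W y u)) := by
  have hf₀ : DifferentiableAt ℝ f y := hf.differentiableAt (by simp)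
  have hW₀ : DifferentiableAt ℝ W y := hW.differentiableAt (by simp)
  have hf₁ := differentiableAt_fderiv_of_contDiffAt hf
  have hW₁ := differentiableAt_fderiv_of_contDiffAt hW
  have hderiv := (hW₁.hasFDerivAt.clm_apply (hasFDerivAt_const v y)).add
    (((hΓ.hasFDerivAt.comp y hf₀.hasFDerivAt).clm_apply
      (hf₁.hasFDerivAt.clm_apply (hasFDerivAt_const v y))).clm_apply hW₀.hasFDerivAt)
  refine (congrArg (· u) hderiv.fderiv).trans ?_
  simp only [ContinuousLinearMap.comp_zero, zero_add, Function.comp_apply, add_apply,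
    ContinuousLinearMap.flip_add, ContinuousLinearMap.flip_apply, ContinuousLinearMap.comp_apply]
  abel

theorem covDerivAlong_comm (hΓ : DifferentiableAt ℝ (christoffel G) (f y))
    (hf : ContDiffAt ℝ 2 f y) (hW : ContDiffAt ℝ 2 W y) (u v : E) :
    covDerivAlong G f u (covDerivAlong G f v W) y - covDerivAlong G f v (covDerivAlong G f u W) y =
      fderiv ℝ (christoffel G) (f y) (fderiv ℝ f y u) (fderiv ℝ f y v) (W y) -
      fderiv ℝ (christoffel G) (f y) (fderiv ℝ f y v) (fderiv ℝ f y u) (W y) +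
      christoffel G (f y) (fderiv ℝ f y u) (christoffel G (f y) (fderiv ℝ f y v) (W y)) -
      christoffel G (f y) (fderiv ℝ f y v) (christoffel G (f y) (fderiv ℝ f y u) (W y)) := by
  simp only [covDerivAlong_apply G f _ (covDerivAlong G f _ W), fderiv_covDerivAlong hΓ hf hW]
  simp only [covDerivAlong_apply, map_add, hf.isSymmSndFDerivAt (by simp) u v,
    hW.isSymmSndFDerivAt (by simp) u v]
  abel

theorem riemannCoord_eq {x : F} (hΓ : DifferentiableAt ℝ (christoffel G) x) (u v w : F) :
    riemannCoord G x u v w = fderiv ℝ (christoffel G) x u v w - fderiv ℝ (christoffel G) x v u w +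
      christoffel G x u (christoffel G x v w) - christoffel G x v (christoffel G x u w) := by
  simpa [riemannCoord] using
    covDerivAlong_comm (f := id) hΓ contDiffAt_id (contDiffAt_const (c := w)) u v

theorem covDerivAlong_comm_eq_riemannCoord (hΓ : DifferentiableAt ℝ (christoffel G) (f y))
    (hf : ContDiffAt ℝ 2 f y) (hW : ContDiffAt ℝ 2 W y) (u v : E) :
    covDerivAlong G f u (covDerivAlong G f v W) y - covDerivAlong G f v (covDerivAlong G f u W) y =
      riemannCoord G (f y) (fderiv ℝ f y u) (fderiv ℝ f y v) (W y) := by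
  rw [covDerivAlong_comm hΓ hf hW, riemannCoord_eq hΓ]

variable [FiniteDimensional ℝ F]

theorem IsMetricNear.fderiv_inner (h : IsMetricNear G (f y)) (hf : DifferentiableAt ℝ f y)
    (hV : DifferentiableAt ℝ V y) (hW : DifferentiableAt ℝ W y) (u : E) :
    fderiv ℝ (fun z => G (f z) (V z) (W z)) y u =
      G (f y) (covDerivAlong G f u V y) (W y) + G (f y) (V y) (covDerivAlong G f u W y) := by
  have hderiv := ((h.differentiableAt.hasFDerivAt.comp y hf.hasFDerivAt).clm_apply
    hV.hasFDerivAt).clm_apply hW.hasFDerivAt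
  refine (congrArg (· u) hderiv.fderiv).trans ?_
  simp only [Function.comp_apply, ContinuousLinearMap.flip_add, ContinuousLinearMap.flip_apply,
    ContinuousLinearMap.comp_apply, add_apply, h.fderiv_eq, covDerivAlong_apply, map_add]
  abel

theorem IsMetricNear.fderiv_fderiv_inner (h : IsMetricNear G (f y)) (hf : ContDiffAt ℝ 2 f y)
    (hV : ContDiffAt ℝ 2 V y) (hW : ContDiffAt ℝ 2 W y) (u v : E) :
    fderiv ℝ (fun z => fderiv ℝ (fun z => G (f z) (V z) (W z)) z v) y u =
      G (f y) (covDerivAlong G f u (covDerivAlong G f v V) y) (W y) +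
      G (f y) (covDerivAlong G f v V y) (covDerivAlong G f u W y) +
      (G (f y) (covDerivAlong G f u V y) (covDerivAlong G f v W y) +
      G (f y) (V y) (covDerivAlong G f u (covDerivAlong G f v W) y)) := by
  have hΓ := h.differentiableAt_christoffel
  have hf₀ : DifferentiableAt ℝ f y := hf.differentiableAt (by simp)
  have hV₀ : DifferentiableAt ℝ V y := hV.differentiableAt (by simp)
  have hW₀ : DifferentiableAt ℝ W y := hW.differentiableAt (by simp)
  have hV₁ := differentiableAt_covDerivAlong hΓ hf hV v
  have hW₁ := differentiableAt_covDerivAlong hΓ hf hW v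
  have hG := h.differentiableAt
  have hfirst : (fun z => fderiv ℝ (fun z => G (f z) (V z) (W z)) z v) =ᶠ[𝓝 y] fun z =>
      G (f z) (covDerivAlong G f v V z) (W z) + G (f z) (V z) (covDerivAlong G f v W z) := by
    filter_upwards [hf₀.continuousAt.eventually h.eventually, hf.eventually (by simp),
      hV.eventually (by simp), hW.eventually (by simp)] with z hz hfz hVz hWz
    exact hz.fderiv_inner (hfz.differentiableAt (by simp)) (hVz.differentiableAt (by simp))
      (hWz.differentiableAt (by simp)) v
  rw [hfirst.fderiv_eq, fderiv_fun_add (by fun_prop) (by fun_prop), add_apply,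
    h.fderiv_inner hf₀ hV₁ hW₀, h.fderiv_inner hf₀ hV₀ hW₁]

end CovariantDerivative

namespace IsMetricNear

variable {G : F → F →L[ℝ] F →L[ℝ] ℝ} {y : F} [FiniteDimensional ℝ F]

theorem riemannCoord_bianchi (h : IsMetricNear G y) (u v w : F) :
    riemannCoord G y u v w + riemannCoord G y v w u + riemannCoord G y w u v = 0 := by
  have hΓ := h.differentiableAt_christoffel
  rw [riemannCoord_eq hΓ, riemannCoord_eq hΓ, riemannCoord_eq hΓ,
    h.fderiv_christoffel_symm u w v, h.fderiv_christoffel_symm v w u,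
    h.fderiv_christoffel_symm w v u, h.christoffel_symm w v, h.christoffel_symm w u,
    h.christoffel_symm v u]
  abel

theorem inner_riemannCoord_skew (h : IsMetricNear G y) (u v w z : F) :
    G y (riemannCoord G y u v w) z = -G y (riemannCoord G y u v z) w := by
  have hC : ContDiffAt ℝ 2 (fun x => G x w z) y :=
    (h.contDiffAt.clm_apply contDiffAt_const).clm_apply contDiffAt_const
  have hsecond : ∀ u v, fderiv ℝ (fderiv ℝ fun x => G x w z) y u v = _ := fun u v =>
    (fderiv_clm_apply_const (differentiableAt_fderiv_of_contDiffAt hC) u v).symm.trans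
      (h.fderiv_fderiv_inner (f := id) contDiffAt_id contDiffAt_const contDiffAt_const u v)
  have hcomm := hC.isSymmSndFDerivAt (by simp) u v
  rw [hsecond, hsecond] at hcomm
  simp only [riemannCoord, map_sub, sub_apply, h.symm _ w]
  simp only [id] at hcomm
  linarith

theorem isCurvatureLike (h : IsMetricNear G y) :
    IsCurvatureLike fun u v w z => G y (riemannCoord G y u v w) z where
  add_left u u' v w z := by
    simp only [riemannCoord_eq h.differentiableAt_christoffel, map_add, map_sub, add_apply,
      sub_apply]
    ring
  smul_left r u v w z := by
    simp only [riemannCoord_eq h.differentiableAt_christoffel, map_add, map_sub, map_smul,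
      add_apply, sub_apply, smul_apply, smul_eq_mul]
    ring
  swap_left u v w z := by rw [riemannCoord_swap, map_neg, neg_apply]
  swap_right := h.inner_riemannCoord_skew
  bianchi u v w z := by
    rw [← add_apply, ← add_apply, ← map_add, ← map_add, h.riemannCoord_bianchi, map_zero,
      zero_apply]

end IsMetricNear

/-- `f` is a `C³` immersion near `y` into a space with metric `G`. -/
structure IsImmersionNear (G : F → F →L[ℝ] F →L[ℝ] ℝ) (f : E → F) (y : E) : Prop where
  metric : IsMetricNear G (f y)
  contDiffAt : ContDiffAt ℝ 3 f y
  eventually_pos : ∀ᶠ z in 𝓝 y, ∀ u, u ≠ 0 → 0 < inducedMetric G f z u u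

section Submanifold

variable {G : F → F →L[ℝ] F →L[ℝ] ℝ} {f : E → F} {y : E}

theorem inducedMetric_apply (u v : E) :
    inducedMetric G f y u v = G (f y) (fderiv ℝ f y u) (fderiv ℝ f y v) := rfl

theorem normalPart_apply (w : F) :
    normalPart G f y w = w - fderiv ℝ f y (tangentialPart G f y w) := rfl

theorem secondFundCoord_apply (u v : E) :
    secondFundCoord G f y u v = normalPart G f y (fderiv ℝ (fderiv ℝ f) y u v +
      christoffel G (f y) (fderiv ℝ f y u) (fderiv ℝ f y v)) := rfl

namespace IsImmersionNear

protected theorem eventually (h : IsImmersionNear G f y) : ∀ᶠ z in 𝓝 y, IsImmersionNear G f z := by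
  filter_upwards [h.contDiffAt.continuousAt.eventually h.metric.eventually,
    h.contDiffAt.eventually (by simp), h.eventually_pos.eventually_nhds] with z hG hC hp
  exact ⟨hG, hC, hp⟩

theorem contDiffAt_two (h : IsImmersionNear G f y) : ContDiffAt ℝ 2 f y :=
  h.contDiffAt.of_le (by norm_num)

theorem differentiableAt (h : IsImmersionNear G f y) : DifferentiableAt ℝ f y :=
  h.contDiffAt.differentiableAt (by simp)

theorem contDiffAt_fderiv (h : IsImmersionNear G f y) : ContDiffAt ℝ 2 (fderiv ℝ f) y :=
  h.contDiffAt.fderiv_right (by norm_num)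

theorem differentiableAt_fderiv (h : IsImmersionNear G f y) : DifferentiableAt ℝ (fderiv ℝ f) y :=
  h.contDiffAt_fderiv.differentiableAt (by simp)

theorem contDiffAt_fderiv_apply (h : IsImmersionNear G f y) (w : E) :
    ContDiffAt ℝ 2 (fun z => fderiv ℝ f z w) y :=
  h.contDiffAt_fderiv.clm_apply contDiffAt_const

theorem isMetricNear_inducedMetric (h : IsImmersionNear G f y) :
    IsMetricNear (inducedMetric G f) y where
  contDiffAt := by
    have hG : ContDiffAt ℝ 2 (fun z => G (f z)) y := h.metric.contDiffAt.comp y h.contDiffAt_two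
    have hflip := (ContinuousLinearMap.flipₗᵢ ℝ E F ℝ).contDiff.contDiffAt.comp y
      (hG.clm_comp h.contDiffAt_fderiv)
    exact (ContinuousLinearMap.flipₗᵢ ℝ E E ℝ).contDiff.contDiffAt.comp y
      (hflip.clm_comp h.contDiffAt_fderiv)
  eventually_symm :=
    (h.contDiffAt.continuousAt.eventually h.metric.eventually_symm).mono fun _ hz _ _ => hz _ _
  eventually_pos := h.eventually_pos

theorem covDerivAlong_fderiv (h : IsImmersionNear G f y) (u v : E) :
    covDerivAlong G f u (fun z => fderiv ℝ f z v) y = fderiv ℝ (fderiv ℝ f) y u v +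
      christoffel G (f y) (fderiv ℝ f y u) (fderiv ℝ f y v) := by
  rw [covDerivAlong_apply, fderiv_clm_apply_const h.differentiableAt_fderiv]

theorem normalPart_covDerivAlong_fderiv (h : IsImmersionNear G f y) (u v : E) :
    normalPart G f y (covDerivAlong G f u (fun z => fderiv ℝ f z v) y) =
      secondFundCoord G f y u v := by
  rw [h.covDerivAlong_fderiv, secondFundCoord_apply]

section Ambient

variable [FiniteDimensional ℝ F]

theorem covDerivAlong_fderiv_symm (h : IsImmersionNear G f y) (u v : E) :
    covDerivAlong G f u (fun z => fderiv ℝ f z v) y =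
      covDerivAlong G f v (fun z => fderiv ℝ f z u) y := by
  rw [h.covDerivAlong_fderiv, h.covDerivAlong_fderiv, h.metric.christoffel_symm,
    h.contDiffAt_two.isSymmSndFDerivAt (by simp) u v]

theorem secondFundCoord_symm (h : IsImmersionNear G f y) (u v : E) :
    secondFundCoord G f y u v = secondFundCoord G f y v u := by
  rw [← h.normalPart_covDerivAlong_fderiv, h.covDerivAlong_fderiv_symm,
    h.normalPart_covDerivAlong_fderiv]

theorem fderiv_inducedMetric (h : IsImmersionNear G f y) (u v w : E) :
    fderiv ℝ (inducedMetric G f) y u v w =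
      G (f y) (covDerivAlong G f u (fun z => fderiv ℝ f z v) y) (fderiv ℝ f y w) +
      G (f y) (covDerivAlong G f u (fun z => fderiv ℝ f z w) y) (fderiv ℝ f y v) := by
  have hg := h.isMetricNear_inducedMetric.differentiableAt
  rw [h.metric.symm _ (fderiv ℝ f y v), ← h.metric.fderiv_inner h.differentiableAt
    ((h.contDiffAt_fderiv_apply v).differentiableAt (by simp))
    ((h.contDiffAt_fderiv_apply w).differentiableAt (by simp)), ← fderiv_clm_apply_const hg,
    ← fderiv_clm_apply_const (hg.clm_apply (differentiableAt_const v))]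
  rfl

end Ambient

section Finite

variable [FiniteDimensional ℝ E]

theorem inner_tangentialPart (h : IsImmersionNear G f y) (w : F) (v : E) :
    inducedMetric G f y (tangentialPart G f y w) v = G (f y) w (fderiv ℝ f y v) :=
  congrArg (fun α : E →L[ℝ] ℝ => α v) (h.isMetricNear_inducedMetric.isInvertible.self_apply_inverse
    (G (f y) w ∘L fderiv ℝ f y))

theorem inner_shapeCoord (h : IsImmersionNear G f y) (ξ : F) (u v : E) :
    inducedMetric G f y (shapeCoord G f y ξ u) v = G (f y) (secondFundCoord G f y u v) ξ :=
  congrArg (fun α : E →L[ℝ] ℝ => α v) (h.isMetricNear_inducedMetric.isInvertible.self_apply_inverse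
    ((G (f y)).flip ξ ∘L secondFundCoord G f y u))

theorem normalPart_fderiv (h : IsImmersionNear G f y) (u : E) :
    normalPart G f y (fderiv ℝ f y u) = 0 := by
  have ht : tangentialPart G f y (fderiv ℝ f y u) = u :=
    h.isMetricNear_inducedMetric.ext_inner_left fun v => h.inner_tangentialPart _ v
  rw [normalPart_apply, ht, sub_self]

theorem inner_normalPart_fderiv (h : IsImmersionNear G f y) (w : F) (v : E) :
    G (f y) (normalPart G f y w) (fderiv ℝ f y v) = 0 := by
  rw [normalPart_apply, map_sub, sub_apply, ← inducedMetric_apply, h.inner_tangentialPart, sub_self]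

theorem inner_secondFundCoord_fderiv (h : IsImmersionNear G f y) (u v w : E) :
    G (f y) (secondFundCoord G f y u v) (fderiv ℝ f y w) = 0 :=
  h.inner_normalPart_fderiv _ _

theorem contDiffAt_tangentialPart (h : IsImmersionNear G f y) :
    ContDiffAt ℝ 2 (tangentialPart G f) y := by
  have hinv : ContDiffAt ℝ 2 (fun z => (inducedMetric G f z).inverse) y :=
    h.isMetricNear_inducedMetric.isInvertible.contDiffAt_map_inverse.comp y
      h.isMetricNear_inducedMetric.contDiffAt
  have hG : ContDiffAt ℝ 2 (fun z => G (f z)) y := h.metric.contDiffAt.comp y h.contDiffAt_two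
  exact hinv.clm_comp (((ContinuousLinearMap.compL ℝ E F ℝ).flip.contDiff.contDiffAt.comp y
    h.contDiffAt_fderiv).clm_comp hG)

variable [FiniteDimensional ℝ F]

theorem inner_covDerivAlong_fderiv (h : IsImmersionNear G f y) (u v w : E) :
    G (f y) (covDerivAlong G f u (fun z => fderiv ℝ f z v) y) (fderiv ℝ f y w) =
      inducedMetric G f y (christoffel (inducedMetric G f) y u v) w := by
  rw [h.isMetricNear_inducedMetric.inner_christoffel, christoffelFirst_apply,
    h.fderiv_inducedMetric, h.fderiv_inducedMetric, h.fderiv_inducedMetric,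
    h.covDerivAlong_fderiv_symm w u, h.covDerivAlong_fderiv_symm v u,
    h.covDerivAlong_fderiv_symm w v]
  ring

/-- **Gauss formula**: the tangential part of the ambient connection is the Levi-Civita connection
of the induced metric. -/
theorem covDerivAlong_fderiv_eq (h : IsImmersionNear G f y) (u v : E) :
    covDerivAlong G f u (fun z => fderiv ℝ f z v) y =
      fderiv ℝ f y (christoffel (inducedMetric G f) y u v) + secondFundCoord G f y u v := by
  have ht : tangentialPart G f y (covDerivAlong G f u (fun z => fderiv ℝ f z v) y) =
      christoffel (inducedMetric G f) y u v :=
    h.isMetricNear_inducedMetric.ext_inner_left fun w => by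
      rw [h.inner_tangentialPart, h.inner_covDerivAlong_fderiv]
  rw [← h.normalPart_covDerivAlong_fderiv, normalPart_apply, ht, add_sub_cancel]

theorem inner_covDerivAlong_fderiv_covDerivAlong_fderiv (h : IsImmersionNear G f y)
    (u v w k : E) :
    G (f y) (covDerivAlong G f v (fun z => fderiv ℝ f z w) y)
        (covDerivAlong G f u (fun z => fderiv ℝ f z k) y) =
      inducedMetric G f y (christoffel (inducedMetric G f) y v w)
        (christoffel (inducedMetric G f) y u k) +
      G (f y) (secondFundCoord G f y v w) (secondFundCoord G f y u k) := by
  rw [h.covDerivAlong_fderiv_eq, h.covDerivAlong_fderiv_eq, map_add, map_add, add_apply,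
    add_apply, h.inner_secondFundCoord_fderiv, h.metric.symm _ (secondFundCoord G f y u k),
    h.inner_secondFundCoord_fderiv, zero_add, add_zero, inducedMetric_apply]

theorem inner_covDerivAlong_covDerivAlong_fderiv (h : IsImmersionNear G f y) (u v w k : E) :
    G (f y) (covDerivAlong G f u (covDerivAlong G f v (fun z => fderiv ℝ f z w)) y)
        (fderiv ℝ f y k) =
      inducedMetric G f y (covDerivAlong (inducedMetric G f) id u
        (covDerivAlong (inducedMetric G f) id v (fun _ => w)) y) k -
      G (f y) (secondFundCoord G f y v w) (secondFundCoord G f y u k) := by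
  have hg := h.isMetricNear_inducedMetric
  have hconst : ∀ v w z, covDerivAlong (inducedMetric G f) id v (fun _ => w) z =
      christoffel (inducedMetric G f) z v w := fun v w z => by simp [covDerivAlong_apply]
  have hfirst : (fun z => G (f z) (covDerivAlong G f v (fun z => fderiv ℝ f z w) z)
        (fderiv ℝ f z k)) =ᶠ[𝓝 y] fun z =>
      inducedMetric G f (id z) (covDerivAlong (inducedMetric G f) id v (fun _ => w) z) k :=
    h.eventually.mono fun z hz => by
      simp only [hz.inner_covDerivAlong_fderiv, hconst, id]
  have hambient := h.metric.fderiv_inner h.differentiableAt (differentiableAt_covDerivAlong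
    h.metric.differentiableAt_christoffel h.contDiffAt_two (h.contDiffAt_fderiv_apply w) v)
    ((h.contDiffAt_fderiv_apply k).differentiableAt (by simp)) u
  have hinduced := IsMetricNear.fderiv_inner (f := id) hg differentiableAt_id
    (differentiableAt_covDerivAlong (f := id) hg.differentiableAt_christoffel contDiffAt_id
      (contDiffAt_const (c := w)) v) (differentiableAt_const k) u
  rw [hfirst.fderiv_eq, hinduced, h.inner_covDerivAlong_fderiv_covDerivAlong_fderiv] at hambient
  simp only [id, hconst] at hambient ⊢
  linarith

theorem gauss_equation (h : IsImmersionNear G f y) (u v w k : E) :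
    inducedMetric G f y (riemannCoord (inducedMetric G f) y u v w) k =
      G (f y) (riemannCoord G (f y) (fderiv ℝ f y u) (fderiv ℝ f y v) (fderiv ℝ f y w))
        (fderiv ℝ f y k) +
      G (f y) (secondFundCoord G f y v w) (secondFundCoord G f y u k) -
      G (f y) (secondFundCoord G f y u w) (secondFundCoord G f y v k) := by
  rw [← covDerivAlong_comm_eq_riemannCoord h.metric.differentiableAt_christoffel h.contDiffAt_two
    (h.contDiffAt_fderiv_apply w) u v, riemannCoord, map_sub, map_sub, sub_apply, sub_apply,
    h.inner_covDerivAlong_covDerivAlong_fderiv, h.inner_covDerivAlong_covDerivAlong_fderiv]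
  ring

/-- **Weingarten formula**. -/
theorem tangentialPart_covDerivAlong (h : IsImmersionNear G f y) {ξ : E → F}
    (hξ : DifferentiableAt ℝ ξ y)
    (hn : ∀ᶠ z in 𝓝 y, ∀ u, G (f z) (fderiv ℝ f z u) (ξ z) = 0) (v : E) :
    tangentialPart G f y (covDerivAlong G f v ξ y) = -shapeCoord G f y (ξ y) v := by
  refine h.isMetricNear_inducedMetric.ext_inner_left fun w => ?_
  have hderiv := h.metric.fderiv_inner h.differentiableAt
    ((h.contDiffAt_fderiv_apply w).differentiableAt (by simp)) hξ v
  have hzero : (fun z => G (f z) (fderiv ℝ f z w) (ξ z)) =ᶠ[𝓝 y] fun _ => 0 :=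
    hn.mono fun z hz => hz w
  rw [hzero.fderiv_eq, fderiv_fun_const, Pi.zero_apply, zero_apply, h.covDerivAlong_fderiv_eq,
    map_add, add_apply, hn.self_of_nhds, zero_add, h.metric.symm (fderiv ℝ f y w)] at hderiv
  rw [h.inner_tangentialPart, map_neg, neg_apply, h.inner_shapeCoord]
  linarith

theorem normalConnCoord_normalConnCoord (h : IsImmersionNear G f y) {ξ : E → F}
    (hξ : ContDiffAt ℝ 2 ξ y)
    (hn : ∀ᶠ z in 𝓝 y, ∀ u, G (f z) (fderiv ℝ f z u) (ξ z) = 0) (u v : E) :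
    normalConnCoord G f u (normalConnCoord G f v ξ) y =
      normalPart G f y (covDerivAlong G f u (covDerivAlong G f v ξ) y) +
      secondFundCoord G f y u (shapeCoord G f y (ξ y) v) := by
  have hD := differentiableAt_covDerivAlong h.metric.differentiableAt_christoffel
    h.contDiffAt_two hξ v
  have ht := (h.contDiffAt_tangentialPart.differentiableAt (by simp)).clm_apply hD
  have hderiv : fderiv ℝ (normalConnCoord G f v ξ) y = _ :=
    (hD.hasFDerivAt.sub (h.differentiableAt_fderiv.hasFDerivAt.clm_apply ht.hasFDerivAt)).fderiv
  have hval : normalConnCoord G f v ξ y = covDerivAlong G f v ξ y -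
      fderiv ℝ f y (tangentialPart G f y (covDerivAlong G f v ξ y)) := rfl
  rw [normalConnCoord, covDerivAlong_apply, hderiv, hval,
    h.tangentialPart_covDerivAlong (hξ.differentiableAt (by simp)) hn]
  simp only [sub_apply, map_add, map_sub, map_neg, covDerivAlong_apply G f u,
    secondFundCoord_apply, add_apply, neg_apply, ContinuousLinearMap.comp_apply,
    ContinuousLinearMap.flip_apply, h.normalPart_fderiv]
  abel

theorem ricci_equation (h : IsImmersionNear G f y) {ξ : E → F} (hξ : ContDiffAt ℝ 2 ξ y)
    (hn : ∀ᶠ z in 𝓝 y, ∀ u, G (f z) (fderiv ℝ f z u) (ξ z) = 0) (u v : E) :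
    normalCurvCoord G f u v ξ y =
      normalPart G f y (riemannCoord G (f y) (fderiv ℝ f y u) (fderiv ℝ f y v) (ξ y)) +
      secondFundCoord G f y u (shapeCoord G f y (ξ y) v) -
      secondFundCoord G f y v (shapeCoord G f y (ξ y) u) := by
  rw [normalCurvCoord, h.normalConnCoord_normalConnCoord hξ hn,
    h.normalConnCoord_normalConnCoord hξ hn, ← covDerivAlong_comm_eq_riemannCoord
      h.metric.differentiableAt_christoffel h.contDiffAt_two hξ u v, map_sub]
  abel

end Finite

end IsImmersionNear

end Submanifold

end Coordinates

section Charts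

variable {m : ℕ} {M : Type*} [TopologicalSpace M] [ChartedSpace (EuclideanSpace ℝ (Fin m)) M]

theorem inner_congr_base [IsManifold (𝓡 m) ∞ M] (g : Metric m M) {a b : M} (h : a = b)
    (u v : EuclideanSpace ℝ (Fin m)) :
    g.inner a (u : TangentSpace (𝓡 m) a) (v : TangentSpace (𝓡 m) a) =
      g.inner b (u : TangentSpace (𝓡 m) b) (v : TangentSpace (𝓡 m) b) := by
  subst h
  rfl

section OneSmooth

variable [IsManifold (𝓡 m) 1 M]

theorem mdifferentiableAt_extChartAt_symm {x : M} {y : EuclideanSpace ℝ (Fin m)}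
    (hy : y ∈ (extChartAt (𝓡 m) x).target) :
    MDifferentiableAt (𝓡 m) (𝓡 m) (extChartAt (𝓡 m) x).symm y := by
  simpa only [ModelWithCorners.range_eq_univ, mdifferentiableWithinAt_univ] using
    mdifferentiableWithinAt_extChartAt_symm (I := 𝓡 m) hy

theorem isInvertible_mfderiv_extChartAt_symm {x : M} {y : EuclideanSpace ℝ (Fin m)}
    (hy : y ∈ (extChartAt (𝓡 m) x).target) :
    (mfderiv (𝓡 m) (𝓡 m) (extChartAt (𝓡 m) x).symm y).IsInvertible := by
  simpa only [ModelWithCorners.range_eq_univ, mfderivWithin_univ] using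
    isInvertible_mfderivWithin_extChartAt_symm (I := 𝓡 m) hy

theorem mfderiv_extChartAt_symm_self (x : M) :
    mfderiv (𝓡 m) (𝓡 m) (extChartAt (𝓡 m) x).symm (extChartAt (𝓡 m) x x) =
      ContinuousLinearMap.id ℝ (EuclideanSpace ℝ (Fin m)) := by
  have h := mfderivWithin_range_extChartAt_symm (I := 𝓡 m) (x := x)
  rwa [ModelWithCorners.range_eq_univ, mfderivWithin_univ] at h

end OneSmooth

variable [IsManifold (𝓡 m) ∞ M]

theorem contMDiffOn_mfderiv_extChartAt_symm (x : M) (u : EuclideanSpace ℝ (Fin m)) :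
    ContMDiffOn (𝓡 m) ((𝓡 m).prod (𝓡 m)) ∞
      (fun y => (⟨(extChartAt (𝓡 m) x).symm y,
        mfderiv (𝓡 m) (𝓡 m) (extChartAt (𝓡 m) x).symm y u⟩ : TangentBundle (𝓡 m) M))
      (extChartAt (𝓡 m) x).target := by
  have hopen := isOpen_extChartAt_target (I := 𝓡 m) x
  have hsymm : ContMDiffOn (𝓡 m) (𝓡 m) ∞ (extChartAt (𝓡 m) x).symm (extChartAt (𝓡 m) x).target :=
    contMDiffOn_extChartAt_symm x
  have hconst : ContMDiff (𝓡 m) ((𝓡 m).prod (𝓡 m)) ∞ (fun y : EuclideanSpace ℝ (Fin m) =>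
      (⟨y, u⟩ : TangentBundle (𝓡 m) (EuclideanSpace ℝ (Fin m)))) :=
    contMDiff_vectorSpace_iff_contDiff.2 contDiff_const
  refine ((hsymm.contMDiffOn_tangentMapWithin (m := ∞) (by simp) hopen.uniqueMDiffOn).comp
    hconst.contMDiffOn fun y hy => hy).congr fun y hy => ?_
  simp only [Function.comp, tangentMapWithin, mfderivWithin_of_isOpen hopen hy]

theorem chartMetric_self (g : Metric m M) (x : M) (u v : TangentSpace (𝓡 m) x) :
    chartMetric g x (extChartAt (𝓡 m) x x) u v = g.inner x u v := by
  have : IsManifold (𝓡 m) 1 M := IsManifold.of_le (n := ∞) (by simp)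
  have hid : ∀ u : EuclideanSpace ℝ (Fin m), (mfderiv (𝓡 m) (𝓡 m) (extChartAt (𝓡 m) x).symm
      (extChartAt (𝓡 m) x x) u : EuclideanSpace ℝ (Fin m)) = u :=
    fun u => DFunLike.congr_fun (mfderiv_extChartAt_symm_self x) u
  exact (inner_congr_base g (extChartAt_to_inv x) _ _).trans
    (congrArg₂ (fun a b : EuclideanSpace ℝ (Fin m) =>
      g.inner x (a : TangentSpace (𝓡 m) x) (b : TangentSpace (𝓡 m) x)) (hid u) (hid v))

theorem contDiffOn_chartMetric (g : Metric m M) (x : M) :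
    ContDiffOn ℝ ∞ (chartMetric g x) (extChartAt (𝓡 m) x).target := by
  refine contDiffOn_clm_apply.2 fun u => contDiffOn_clm_apply.2 fun v =>
    contMDiffOn_iff_contDiffOn.1 fun y hy => ?_
  have hg := g.contMDiff.contMDiffAt.comp_contMDiffWithinAt y (contMDiffOn_extChartAt_symm x y hy)
  have hsection : ContMDiffWithinAt (𝓡 m) ((𝓡 m).prod 𝓘(ℝ, ℝ)) ∞
      (fun y => Bundle.TotalSpace.mk' ℝ (E := Bundle.Trivial M ℝ) ((extChartAt (𝓡 m) x).symm y)
        (g.inner ((extChartAt (𝓡 m) x).symm y)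
          (mfderiv (𝓡 m) (𝓡 m) (extChartAt (𝓡 m) x).symm y u)
          (mfderiv (𝓡 m) (𝓡 m) (extChartAt (𝓡 m) x).symm y v)))
      (extChartAt (𝓡 m) x).target y :=
    ContMDiffWithinAt.clm_bundle_apply₂ (F₁ := EuclideanSpace ℝ (Fin m))
      (F₂ := EuclideanSpace ℝ (Fin m)) hg (contMDiffOn_mfderiv_extChartAt_symm x u y hy)
      (contMDiffOn_mfderiv_extChartAt_symm x v y hy)
  exact (Bundle.contMDiffWithinAt_totalSpace.1 hsection).2

theorem isMetricNear_chartMetric (g : Metric m M) (x : M) :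
    IsMetricNear (chartMetric g x) (extChartAt (𝓡 m) x x) where
  contDiffAt := ((contDiffOn_chartMetric g x).contDiffAt (extChartAt_target_mem_nhds x)).of_le
    ENat.LEInfty.out
  eventually_symm := .of_forall fun z u v => g.symm _ _ _
  eventually_pos := by
    filter_upwards [extChartAt_target_mem_nhds x] with z hz u hu
    have : IsManifold (𝓡 m) 1 M := IsManifold.of_le (n := ∞) (by simp)
    have hinv := isInvertible_mfderiv_extChartAt_symm hz
    rw [chartMetric_apply]
    exact g.pos _ _ fun h0 => hu (hinv.injective (h0.trans (map_zero _).symm))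

theorem isCurvatureLike_riemann (g : Metric m M) (x : M) :
    IsCurvatureLike fun u v w z => g.inner x (riemann g x u v w) z := by
  have hT : (fun u v w z : EuclideanSpace ℝ (Fin m) =>
      chartMetric g x (extChartAt (𝓡 m) x x)
        (riemannCoord (chartMetric g x) (extChartAt (𝓡 m) x x) u v w) z) =
      fun u v w z => g.inner x (riemann g x u v w) z := by
    funext u v w z
    exact chartMetric_self g x _ _
  exact hT ▸ (isMetricNear_chartMetric g x).isCurvatureLike

end Charts

section Immersions

variable {n d : ℕ} {M : Type*} [TopologicalSpace M] [ChartedSpace (EuclideanSpace ℝ (Fin n)) M]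
  {N : Type*} [TopologicalSpace N] [ChartedSpace (EuclideanSpace ℝ (Fin d)) N]

theorem writtenInExtChartAt_self (φ : M → N) (x : M) :
    writtenInExtChartAt (𝓡 n) (𝓡 d) x φ (extChartAt (𝓡 n) x x) =
      extChartAt (𝓡 d) (φ x) (φ x) := by
  simp [writtenInExtChartAt]

theorem extChartAt_symm_comp_writtenInExtChartAt {φ : M → N} (hφ : Continuous φ) (x : M) :
    ∀ᶠ z in 𝓝 (extChartAt (𝓡 n) x x),
      writtenInExtChartAt (𝓡 n) (𝓡 d) x φ z ∈ (extChartAt (𝓡 d) (φ x)).target ∧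
      (extChartAt (𝓡 d) (φ x)).symm (writtenInExtChartAt (𝓡 n) (𝓡 d) x φ z) =
        φ ((extChartAt (𝓡 n) x).symm z) := by
  have hc : Filter.Tendsto (fun z => φ ((extChartAt (𝓡 n) x).symm z))
      (𝓝 (extChartAt (𝓡 n) x x)) (𝓝 (φ x)) := by
    have := (continuousAt_extChartAt_symm (I := 𝓡 n) x).tendsto
    rw [extChartAt_to_inv] at this
    exact hφ.continuousAt.tendsto.comp this
  filter_upwards [hc.eventually (extChartAt_source_mem_nhds (I := 𝓡 d) (φ x))] with z hz
  exact ⟨(extChartAt (𝓡 d) (φ x)).map_source hz, (extChartAt (𝓡 d) (φ x)).left_inv hz⟩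

variable [IsManifold (𝓡 n) ∞ M] [IsManifold (𝓡 d) ∞ N] {g : Metric n M} {gN : Metric d N}
  {φ : M → N}

namespace IsIsometricImmersion

theorem contDiffAt (h : IsIsometricImmersion g gN φ) (x : M) :
    ContDiffAt ℝ ∞ (writtenInExtChartAt (𝓡 n) (𝓡 d) x φ) (extChartAt (𝓡 n) x x) := by
  have hx := (contMDiffAt_iff.1 (h.contMDiff x)).2
  rwa [ModelWithCorners.range_eq_univ, contDiffWithinAt_univ] at hx

theorem mdifferentiableAt (h : IsIsometricImmersion g gN φ) (x : M) :
    MDifferentiableAt (𝓡 n) (𝓡 d) φ x :=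
  (h.contMDiff x).mdifferentiableAt (by simp)

theorem fderiv_writtenInExtChartAt (h : IsIsometricImmersion g gN φ) (x : M) :
    fderiv ℝ (writtenInExtChartAt (𝓡 n) (𝓡 d) x φ) (extChartAt (𝓡 n) x x) =
      mfderiv (𝓡 n) (𝓡 d) φ x := by
  rw [(h.mdifferentiableAt x).mfderiv, ModelWithCorners.range_eq_univ, fderivWithin_univ]

theorem mfderiv_extChartAt_symm_fderiv (h : IsIsometricImmersion g gN φ) (x : M) :
    ∀ᶠ z in 𝓝 (extChartAt (𝓡 n) x x), ∀ u : EuclideanSpace ℝ (Fin n),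
      (mfderiv (𝓡 d) (𝓡 d) (extChartAt (𝓡 d) (φ x)).symm (writtenInExtChartAt (𝓡 n) (𝓡 d) x φ z)
        (fderiv ℝ (writtenInExtChartAt (𝓡 n) (𝓡 d) x φ) z u) : EuclideanSpace ℝ (Fin d)) =
      mfderiv (𝓡 n) (𝓡 d) φ ((extChartAt (𝓡 n) x).symm z)
        (mfderiv (𝓡 n) (𝓡 n) (extChartAt (𝓡 n) x).symm z u) := by
  have : IsManifold (𝓡 n) 1 M := IsManifold.of_le (n := ∞) (by simp)
  have : IsManifold (𝓡 d) 1 N := IsManifold.of_le (n := ∞) (by simp)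
  filter_upwards [(extChartAt_symm_comp_writtenInExtChartAt (n := n) (d := d) h.contMDiff.continuous
    x).eventually_nhds, extChartAt_target_mem_nhds x, ((h.contDiffAt x).of_le
      (m := 1) (by exact_mod_cast le_top)).eventually (by simp)] with z hz hzt hfz u
  have hdz : MDifferentiableAt (𝓡 n) (𝓡 d) (writtenInExtChartAt (𝓡 n) (𝓡 d) x φ) z :=
    (hfz.differentiableAt (by simp)).mdifferentiableAt
  have hleft := mfderiv_comp z (mdifferentiableAt_extChartAt_symm hz.self_of_nhds.1) hdz
  have hright := mfderiv_comp z (h.mdifferentiableAt _) (mdifferentiableAt_extChartAt_symm hzt)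
  have heq : (extChartAt (𝓡 d) (φ x)).symm ∘ writtenInExtChartAt (𝓡 n) (𝓡 d) x φ =ᶠ[𝓝 z]
      φ ∘ (extChartAt (𝓡 n) x).symm := hz.mono fun _ hz' => hz'.2
  have hmid : (mfderiv (𝓡 n) (𝓡 d) ((extChartAt (𝓡 d) (φ x)).symm ∘
      writtenInExtChartAt (𝓡 n) (𝓡 d) x φ) z u : EuclideanSpace ℝ (Fin d)) =
      mfderiv (𝓡 n) (𝓡 d) (φ ∘ (extChartAt (𝓡 n) x).symm) z u :=
    DFunLike.congr_fun (heq.mfderiv_eq (I := 𝓡 n) (I' := 𝓡 d)) u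
  rw [mfderiv_eq_fderiv] at hleft
  exact (DFunLike.congr_fun hleft u).symm.trans (hmid.trans (DFunLike.congr_fun hright u))

theorem chartMetric_eventuallyEq (h : IsIsometricImmersion g gN φ) (x : M) :
    chartMetric g x =ᶠ[𝓝 (extChartAt (𝓡 n) x x)]
      inducedMetric (chartMetric gN (φ x)) (writtenInExtChartAt (𝓡 n) (𝓡 d) x φ) := by
  filter_upwards [h.mfderiv_extChartAt_symm_fderiv x,
    extChartAt_symm_comp_writtenInExtChartAt (n := n) (d := d) h.contMDiff.continuous x]
    with z hD hz
  ext u v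
  rw [inducedMetric_apply, chartMetric_apply, chartMetric_apply, ← h.isometric]
  refine (inner_congr_base gN hz.2.symm _ _).trans ?_
  rw [← hD u, ← hD v]

theorem isImmersionNear (h : IsIsometricImmersion g gN φ) (x : M) :
    IsImmersionNear (chartMetric gN (φ x)) (writtenInExtChartAt (𝓡 n) (𝓡 d) x φ)
      (extChartAt (𝓡 n) x x) where
  metric := by
    rw [writtenInExtChartAt_self]
    exact isMetricNear_chartMetric gN (φ x)
  contDiffAt := (h.contDiffAt x).of_le ENat.LEInfty.out
  eventually_pos := by
    filter_upwards [h.chartMetric_eventuallyEq x, (isMetricNear_chartMetric g x).eventually_pos]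
      with z heq hpos
    rwa [← heq]

end IsIsometricImmersion

end Immersions

section SymmetricForms

open scoped RealInnerProductSpace
open Module InnerProductSpace

variable {V W : Type*} [NormedAddCommGroup V] [InnerProductSpace ℝ V]
  [NormedAddCommGroup W] [InnerProductSpace ℝ W] {ι κ : Type*} [Fintype ι] [Fintype κ]

variable {L : Submodule ℝ V} {ν : V} {h : V →ₗ[ℝ] V →ₗ[ℝ] W}

/-- `ν` is a unit normal vector of the hyperplane `L`. -/
structure IsUnitNormal (L : Submodule ℝ V) (ν : V) : Prop where
  norm_eq_one : ‖ν‖ = 1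
  mem_orthogonal : ν ∈ Lᗮ
  finrank_add_one : finrank ℝ L + 1 = finrank ℝ V

theorem IsUnitNormal.two_mul_finrank_sub_one_pos (hν : IsUnitNormal L ν) :
    (0 : ℝ) < 2 * finrank ℝ V - 1 := by
  rw [← hν.finrank_add_one]
  push_cast
  linarith [(finrank ℝ L).cast_nonneg (α := ℝ)]

theorem IsUnitNormal.exists_orthonormalBasis (hν : IsUnitNormal L ν) (b : OrthonormalBasis ι ℝ L) :
    ∃ e : OrthonormalBasis (Option ι) ℝ V, e none = ν ∧ ∀ i, e (some i) = b i := by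
  classical
  let v : Option ι → V := fun o => o.elim ν fun i => b i
  have hν' : ∀ i, ⟪(b i : V), ν⟫ = 0 := fun i => hν.mem_orthogonal _ (b i).2
  have hv : Orthonormal ℝ v := by
    rw [orthonormal_iff_ite]
    rintro (_ | i) (_ | j)
    · simp [v, hν.norm_eq_one]
    · simpa [v] using (real_inner_comm _ _).trans (hν' j)
    · simp [v, hν']
    · simpa [v] using orthonormal_iff_ite.1 b.orthonormal i j
  have hcard : Fintype.card (Option ι) = finrank ℝ V := by
    rw [Fintype.card_option, ← finrank_eq_card_basis b.toBasis, hν.finrank_add_one]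
  have hcoe := coe_basisOfOrthonormalOfCardEqFinrank hv hcard
  refine ⟨(basisOfOrthonormalOfCardEqFinrank hv hcard).toOrthonormalBasis (by rwa [hcoe]), ?_, ?_⟩
    <;> simp [v]

/-- The form `(u, v) ↦ (2⟪u, v⟫ - ⟪u, ν⟫⟪v, ν⟫) η`. For a unit vector `ν`, its component along a
vector `ξ` has matrix `diag(2λ, …, 2λ, λ)` with `λ = ⟪η, ξ⟫` in any orthonormal basis ending
with `ν`. -/
def idealForm (ν : V) (η : W) : V →ₗ[ℝ] V →ₗ[ℝ] W :=
  LinearMap.mk₂ ℝ (fun u v => (2 * ⟪u, v⟫ - ⟪u, ν⟫ * ⟪v, ν⟫) • η)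
    (fun _ _ _ => by simp only [inner_add_left]; module)
    (fun _ _ _ => by simp only [real_inner_smul_left]; module)
    (fun _ _ _ => by simp only [inner_add_left, inner_add_right]; module)
    (fun _ _ _ => by simp only [real_inner_smul_left, real_inner_smul_right]; module)

theorem idealForm_apply (ν : V) (η : W) (u v : V) :
    idealForm ν η u v = (2 * ⟪u, v⟫ - ⟪u, ν⟫ * ⟪v, ν⟫) • η := rfl

theorem idealForm_symm (ν : V) (η : W) (u v : V) : idealForm ν η u v = idealForm ν η v u := by
  rw [idealForm_apply, idealForm_apply, real_inner_comm u v, mul_comm ⟪u, ν⟫]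

theorem sub_idealForm_symm (hs : ∀ u v, h u v = h v u) (ν : V) (η : W) (u v : V) :
    (h - idealForm ν η) u v = (h - idealForm ν η) v u := by
  simp only [LinearMap.sub_apply, hs u v, idealForm_symm ν η u v]

theorem idealForm_domRestrict (hν : ν ∈ Lᗮ) (η : W) :
    (idealForm ν η).domRestrict₁₂ L L = idealForm 0 η := by
  refine LinearMap.ext₂ fun u v => ?_
  simp [LinearMap.domRestrict₁₂_apply, idealForm_apply,
    Submodule.inner_right_of_mem_orthogonal u.2 hν]

variable [FiniteDimensional ℝ V]

theorem sum_apply_orthonormalBasis_eq {X : Type*} [AddCommGroup X] [Module ℝ X]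
    (B : V →ₗ[ℝ] V →ₗ[ℝ] X) (e : OrthonormalBasis ι ℝ V) (f : OrthonormalBasis κ ℝ V) :
    ∑ i, B (e i) (e i) = ∑ j, B (f j) (f j) := by
  have h := congrArg (TensorProduct.lift B)
    ((canonicalCovariantTensor_eq_sum V e).symm.trans (canonicalCovariantTensor_eq_sum V f))
  simpa only [map_sum, TensorProduct.lift.tmul] using h

theorem sum_norm_sq_orthonormalBasis_eq (T : V →ₗ[ℝ] W) (e : OrthonormalBasis ι ℝ V)
    (f : OrthonormalBasis κ ℝ V) : ∑ i, ‖T (e i)‖ ^ 2 = ∑ j, ‖T (f j)‖ ^ 2 := by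
  simpa [real_inner_self_eq_norm_sq] using
    sum_apply_orthonormalBasis_eq ((innerₗ W).compl₁₂ T T) e f

/-- The trace `∑ h(eᵢ, eᵢ)` of a vector-valued bilinear form; for the second fundamental form this
is `n` times the mean curvature vector. -/
def formTrace (h : V →ₗ[ℝ] V →ₗ[ℝ] W) : W :=
  ∑ i, h (stdOrthonormalBasis ℝ V i) (stdOrthonormalBasis ℝ V i)

theorem formTrace_eq_sum (h : V →ₗ[ℝ] V →ₗ[ℝ] W) (e : OrthonormalBasis ι ℝ V) :
    formTrace h = ∑ i, h (e i) (e i) :=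
  sum_apply_orthonormalBasis_eq h _ e

/-- The squared Hilbert–Schmidt norm `∑ |h(eᵢ, eⱼ)|²` of a vector-valued bilinear form; for the
second fundamental form restricted to an `l`-dimensional subspace this is `l` times the Casorati
curvature. -/
def formNormSq (h : V →ₗ[ℝ] V →ₗ[ℝ] W) : ℝ :=
  ∑ i, ∑ j, ‖h (stdOrthonormalBasis ℝ V i) (stdOrthonormalBasis ℝ V j)‖ ^ 2

theorem formNormSq_eq_sum (h : V →ₗ[ℝ] V →ₗ[ℝ] W) (e : OrthonormalBasis ι ℝ V) :
    formNormSq h = ∑ i, ∑ j, ‖h (e i) (e j)‖ ^ 2 := by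
  calc formNormSq h = ∑ i, ∑ j, ‖h (stdOrthonormalBasis ℝ V i) (e j)‖ ^ 2 :=
        Finset.sum_congr rfl fun i _ => sum_norm_sq_orthonormalBasis_eq (h _) _ e
    _ = ∑ j, ∑ i, ‖h.flip (e j) (stdOrthonormalBasis ℝ V i)‖ ^ 2 := Finset.sum_comm
    _ = ∑ j, ∑ i, ‖h.flip (e j) (e i)‖ ^ 2 :=
        Finset.sum_congr rfl fun j _ => sum_norm_sq_orthonormalBasis_eq (h.flip _) _ e
    _ = ∑ i, ∑ j, ‖h (e i) (e j)‖ ^ 2 := Finset.sum_comm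

theorem formNormSq_nonneg (h : V →ₗ[ℝ] V →ₗ[ℝ] W) : 0 ≤ formNormSq h := by
  unfold formNormSq; positivity

theorem eq_zero_of_formNormSq_eq_zero (h0 : formNormSq h = 0) : h = 0 := by
  let b := stdOrthonormalBasis ℝ V
  have hb : ∀ i j, h (b i) (b j) = 0 := by
    intro i j
    have hi := (Finset.sum_eq_zero_iff_of_nonneg fun i _ =>
      Finset.sum_nonneg fun j _ => sq_nonneg _).1 h0 i (Finset.mem_univ i)
    have hij := (Finset.sum_eq_zero_iff_of_nonneg fun j _ => sq_nonneg _).1 hi j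
      (Finset.mem_univ j)
    simpa [b] using hij
  exact b.toBasis.ext fun i => b.toBasis.ext fun j => by simpa using hb i j

theorem exists_isUnitNormal (hL : finrank ℝ L + 1 = finrank ℝ V) : ∃ ν, IsUnitNormal L ν := by
  have hL' : Lᗮ ≠ ⊥ := fun h0 => by
    have := L.finrank_add_finrank_orthogonal
    rw [h0, finrank_bot] at this
    omega
  obtain ⟨w, hw, hw0⟩ := Lᗮ.ne_bot_iff.1 hL'
  exact ⟨(‖w‖)⁻¹ • w, norm_smul_inv_norm hw0, Lᗮ.smul_mem _ hw, hL⟩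

theorem isUnitNormal_orthogonal_span (hν : ‖ν‖ = 1) : IsUnitNormal (ℝ ∙ ν)ᗮ ν where
  norm_eq_one := hν
  mem_orthogonal := Submodule.le_orthogonal_orthogonal _ (Submodule.mem_span_singleton_self ν)
  finrank_add_one := by
    have hν0 : ν ≠ 0 := norm_ne_zero_iff.1 (hν ▸ one_ne_zero)
    rw [← (ℝ ∙ ν).finrank_add_finrank_orthogonal, finrank_span_singleton hν0, add_comm]

theorem formTrace_eq_add (h : V →ₗ[ℝ] V →ₗ[ℝ] W) (hν : IsUnitNormal L ν) :
    formTrace h = formTrace (h.domRestrict₁₂ L L) + h ν ν := by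
  obtain ⟨e, he, heb⟩ := hν.exists_orthonormalBasis (stdOrthonormalBasis ℝ L)
  rw [formTrace_eq_sum h e, Fintype.sum_option]
  simp only [formTrace, LinearMap.domRestrict₁₂_apply, he, heb, add_comm]

theorem formNormSq_eq_add (hs : ∀ u v, h u v = h v u) (hν : IsUnitNormal L ν) :
    formNormSq h = formNormSq (h.domRestrict₁₂ L L) +
      2 * ∑ i, ‖h ν (stdOrthonormalBasis ℝ L i)‖ ^ 2 + ‖h ν ν‖ ^ 2 := by
  obtain ⟨e, he, heb⟩ := hν.exists_orthonormalBasis (stdOrthonormalBasis ℝ L)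
  rw [formNormSq_eq_sum h e]
  simp only [formNormSq, Fintype.sum_option, he, heb, LinearMap.domRestrict₁₂_apply,
    Finset.sum_add_distrib, hs _ ν]
  ring

theorem formNormSq_domRestrict (hs : ∀ u v, h u v = h v u) (hν : IsUnitNormal L ν)
    (e : OrthonormalBasis ι ℝ V) :
    formNormSq (h.domRestrict₁₂ L L) =
      formNormSq h - 2 * ∑ i, ‖h ν (e i)‖ ^ 2 + ‖h ν ν‖ ^ 2 := by
  obtain ⟨f, hf, hfb⟩ := hν.exists_orthonormalBasis (stdOrthonormalBasis ℝ L)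
  rw [sum_norm_sq_orthonormalBasis_eq (h ν) e f, formNormSq_eq_add hs hν, Fintype.sum_option]
  simp only [hf, hfb]
  ring

theorem exists_hyperplane_formNormSq_max [Nontrivial V] (hs : ∀ u v, h u v = h v u) :
    ∃ L : Submodule ℝ V, finrank ℝ L + 1 = finrank ℝ V ∧
      ∀ L' : Submodule ℝ V, finrank ℝ L' + 1 = finrank ℝ V →
        formNormSq (h.domRestrict₁₂ L' L') ≤ formNormSq (h.domRestrict₁₂ L L) := by
  let b := stdOrthonormalBasis ℝ V
  let F : V → ℝ := fun ν => formNormSq h - 2 * ∑ i, ‖h ν (b i)‖ ^ 2 + ‖h ν ν‖ ^ 2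
  have hF : Continuous F := by
    have hc : Continuous fun p : V × V => h p.1 p.2 := h.toContinuousBilinearMap.continuous₂
    have hc₁ : ∀ v, Continuous fun ν => h ν v := fun v => hc.comp (by fun_prop : Continuous (·, v))
    have : Continuous fun ν => h ν ν := hc.comp (by fun_prop : Continuous fun ν => (ν, ν))
    fun_prop
  obtain ⟨ν, hν, hmax⟩ := (isCompact_sphere (0 : V) 1).exists_isMaxOn
    (NormedSpace.sphere_nonempty.2 zero_le_one) hF.continuousOn
  have hL := isUnitNormal_orthogonal_span (mem_sphere_zero_iff_norm.1 hν)
  refine ⟨_, hL.finrank_add_one, fun L' hL' => ?_⟩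
  obtain ⟨ν', hν'⟩ := exists_isUnitNormal hL'
  rw [formNormSq_domRestrict hs hL b, formNormSq_domRestrict hs hν' b]
  exact hmax (mem_sphere_zero_iff_norm.2 hν'.norm_eq_one)

theorem formNormSq_domRestrict_le (hs : ∀ u v, h u v = h v u) (hν : IsUnitNormal L ν) :
    formNormSq (h.domRestrict₁₂ L L) ≤ formNormSq h := by
  rw [formNormSq_eq_add hs hν]
  have : 0 ≤ 2 * ∑ i, ‖h ν (stdOrthonormalBasis ℝ L i)‖ ^ 2 + ‖h ν ν‖ ^ 2 := by positivity
  linarith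

theorem formTrace_idealForm (hν : ‖ν‖ = 1) (η : W) :
    formTrace (idealForm ν η) = (2 * finrank ℝ V - 1 : ℝ) • η := by
  simp only [formTrace, idealForm_apply, ← Finset.sum_smul, Finset.sum_sub_distrib, ← sq,
    OrthonormalBasis.sum_sq_inner_right, hν]
  simp [mul_comm]

theorem formNormSq_sub_idealForm_zero (h : V →ₗ[ℝ] V →ₗ[ℝ] W) (η : W) :
    formNormSq (h - idealForm 0 η) =
      formNormSq h - 4 * ⟪formTrace h, η⟫ + 4 * finrank ℝ V * ‖η‖ ^ 2 := by
  let b := stdOrthonormalBasis ℝ V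
  let k : V →ₗ[ℝ] V →ₗ[ℝ] W := h - idealForm 0 η
  have hk : ∀ i j, ‖k (b i) (b j)‖ ^ 2 = ‖h (b i) (b j)‖ ^ 2 +
      if i = j then 4 * ‖η‖ ^ 2 - 4 * ⟪h (b i) (b i), η⟫ else 0 := by
    intro i j
    rw [LinearMap.sub_apply, LinearMap.sub_apply, idealForm_apply, b.inner_eq_ite]
    split_ifs with hij
    · simp only [← hij, norm_sub_sq_real, norm_smul, real_inner_smul_right, inner_zero_right]
      norm_num
      ring
    · simp
  calc formNormSq k
    _ = ∑ i, ∑ j, ‖k (b i) (b j)‖ ^ 2 := rfl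
    _ = formNormSq h + ∑ i, (4 * ‖η‖ ^ 2 - 4 * ⟪h (b i) (b i), η⟫) := by
      simp only [hk, Finset.sum_add_distrib, Finset.sum_ite_eq, Finset.mem_univ, if_true]
      rfl
    _ = formNormSq h - 4 * ⟪formTrace h, η⟫ + 4 * finrank ℝ V * ‖η‖ ^ 2 := by
      simp only [Finset.sum_sub_distrib, Finset.sum_const, Finset.card_univ, Fintype.card_fin,
        nsmul_eq_mul, ← Finset.mul_sum, ← sum_inner, formTrace, b]
      ring

/-- The part `|h|² - |h|_L|² / 2` of the squared norm of `h` which controls its trace. -/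
def weightedNormSq (h : V →ₗ[ℝ] V →ₗ[ℝ] W) (L : Submodule ℝ V) : ℝ :=
  formNormSq h - formNormSq (h.domRestrict₁₂ L L) / 2

theorem weightedNormSq_sub_idealForm (hs : ∀ u v, h u v = h v u) (hν : IsUnitNormal L ν) (η : W) :
    weightedNormSq (h - idealForm ν η) L =
      weightedNormSq h L - 2 * ⟪formTrace h, η⟫ + (2 * finrank ℝ V - 1) * ‖η‖ ^ 2 := by
  have hL : (h - idealForm ν η).domRestrict₁₂ L L = h.domRestrict₁₂ L L - idealForm 0 η := by
    rw [← idealForm_domRestrict hν.mem_orthogonal]; rfl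
  have hνL : ∀ u : L, (h - idealForm ν η) ν u = h ν u := fun u => by
    rw [LinearMap.sub_apply, LinearMap.sub_apply, idealForm_apply,
      Submodule.inner_left_of_mem_orthogonal u.2 hν.mem_orthogonal,
      Submodule.inner_right_of_mem_orthogonal u.2 hν.mem_orthogonal]
    simp
  have hνν : (h - idealForm ν η) ν ν = h ν ν - η := by
    rw [LinearMap.sub_apply, LinearMap.sub_apply, idealForm_apply, real_inner_self_eq_norm_sq,
      hν.norm_eq_one]
    norm_num
  have hdim : (finrank ℝ V : ℝ) = finrank ℝ L + 1 := mod_cast hν.finrank_add_one.symm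
  simp only [weightedNormSq, formNormSq_eq_add hs hν,
    formNormSq_eq_add (sub_idealForm_symm hs ν η) hν, hL, hνL, hνν, formNormSq_sub_idealForm_zero,
    formTrace_eq_add h hν, inner_add_left, norm_sub_sq_real, hdim]
  ring

theorem formNormSq_le_weightedNormSq (hs : ∀ u v, h u v = h v u) (hν : IsUnitNormal L ν) :
    formNormSq h ≤ 2 * weightedNormSq h L := by
  have := formNormSq_domRestrict_le hs hν
  unfold weightedNormSq
  linarith

/-- The Pythagorean theorem for `weightedNormSq`: the projection of `h` to the ideal forms along
`ν` is determined by the trace of `h`. -/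
theorem weightedNormSq_eq_norm_formTrace_sq_add (hs : ∀ u v, h u v = h v u)
    (hν : IsUnitNormal L ν) :
    (2 * finrank ℝ V - 1) * weightedNormSq h L = ‖formTrace h‖ ^ 2 + (2 * finrank ℝ V - 1) *
      weightedNormSq (h - idealForm ν ((2 * finrank ℝ V - 1 : ℝ)⁻¹ • formTrace h)) L := by
  have hn := hν.two_mul_finrank_sub_one_pos
  rw [weightedNormSq_sub_idealForm hs hν, real_inner_smul_right, real_inner_self_eq_norm_sq,
    norm_smul, mul_pow, Real.norm_eq_abs, sq_abs]
  field

theorem norm_formTrace_sq_le (hs : ∀ u v, h u v = h v u) (hν : IsUnitNormal L ν) :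
    ‖formTrace h‖ ^ 2 ≤ (2 * finrank ℝ V - 1) * weightedNormSq h L := by
  rw [weightedNormSq_eq_norm_formTrace_sq_add hs hν]
  have hD := formNormSq_le_weightedNormSq
    (sub_idealForm_symm hs ν ((2 * finrank ℝ V - 1 : ℝ)⁻¹ • formTrace h)) hν
  exact le_add_of_nonneg_right (mul_nonneg hν.two_mul_finrank_sub_one_pos.le
    (nonneg_of_mul_nonneg_right ((formNormSq_nonneg _).trans hD) two_pos))

theorem eq_idealForm_of_norm_formTrace_sq_eq (hs : ∀ u v, h u v = h v u) (hν : IsUnitNormal L ν)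
    (heq : ‖formTrace h‖ ^ 2 = (2 * finrank ℝ V - 1) * weightedNormSq h L) :
    h = idealForm ν ((2 * finrank ℝ V - 1 : ℝ)⁻¹ • formTrace h) := by
  have hw := weightedNormSq_eq_norm_formTrace_sq_add hs hν
  rw [← heq, left_eq_add, mul_eq_zero_iff_left hν.two_mul_finrank_sub_one_pos.ne'] at hw
  have hD := formNormSq_le_weightedNormSq
    (sub_idealForm_symm hs ν ((2 * finrank ℝ V - 1 : ℝ)⁻¹ • formTrace h)) hν
  rw [hw, mul_zero] at hD
  exact sub_eq_zero.1 (eq_zero_of_formNormSq_eq_zero (hD.antisymm (formNormSq_nonneg _)))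

theorem norm_formTrace_idealForm_sq (hν : IsUnitNormal L ν) (η : W) :
    ‖formTrace (idealForm ν η)‖ ^ 2 =
      (2 * finrank ℝ V - 1) * weightedNormSq (idealForm ν η) L := by
  have hn := hν.two_mul_finrank_sub_one_pos
  have h0 : weightedNormSq (0 : V →ₗ[ℝ] V →ₗ[ℝ] W) L = 0 := by
    simp [weightedNormSq, formNormSq, LinearMap.domRestrict₁₂_apply]
  rw [weightedNormSq_eq_norm_formTrace_sq_add (idealForm_symm ν η) hν,
    formTrace_idealForm hν.norm_eq_one, inv_smul_smul₀ hn.ne', sub_self, h0, mul_zero, add_zero]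

/-- The form is `idealForm ν η` for some unit vector `ν`. -/
def IsIdealForm (h : V →ₗ[ℝ] V →ₗ[ℝ] W) : Prop :=
  ∃ (ν : V) (η : W), ‖ν‖ = 1 ∧ h = idealForm ν η

theorem norm_formTrace_sq_eq_iff (hs : ∀ u v, h u v = h v u)
    (hL : finrank ℝ L + 1 = finrank ℝ V)
    (hmax : ∀ L' : Submodule ℝ V, finrank ℝ L' + 1 = finrank ℝ V →
      formNormSq (h.domRestrict₁₂ L' L') ≤ formNormSq (h.domRestrict₁₂ L L)) :
    ‖formTrace h‖ ^ 2 = (2 * finrank ℝ V - 1) * weightedNormSq h L ↔ IsIdealForm h := by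
  obtain ⟨ν, hν⟩ := exists_isUnitNormal hL
  refine ⟨fun heq => ⟨ν, _, hν.norm_eq_one, eq_idealForm_of_norm_formTrace_sq_eq hs hν heq⟩, ?_⟩
  rintro ⟨ν', η, hν', rfl⟩
  have hL' := isUnitNormal_orthogonal_span hν'
  refine (norm_formTrace_sq_le hs hν).antisymm ?_
  rw [norm_formTrace_idealForm_sq hL']
  have := hmax _ hL'.finrank_add_one
  gcongr
  · exact hL'.two_mul_finrank_sub_one_pos.le
  · unfold weightedNormSq; gcongr

end SymmetricForms

section PointwiseEquations

open scoped Bundle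

theorem riemannCoord_congr {F : Type*} [NormedAddCommGroup F] [NormedSpace ℝ F]
    {G G' : F → F →L[ℝ] F →L[ℝ] ℝ} {y : F} (h : G =ᶠ[𝓝 y] G') (u v w : F) :
    riemannCoord G y u v w = riemannCoord G' y u v w := by
  have hΓ : christoffel G =ᶠ[𝓝 y] christoffel G' := by
    filter_upwards [h, h.fderiv (𝕜 := ℝ)] with z hz hdz
    simp only [christoffel, christoffelFirst, hz, hdz]
  have hcov (v : F) :
      covDerivAlong G id v (fun _ => w) =ᶠ[𝓝 y] covDerivAlong G' id v (fun _ => w) := by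
    filter_upwards [hΓ] with z hz
    simp only [covDerivAlong, id, hz]
  have hcov₂ (u v : F) : covDerivAlong G id u (covDerivAlong G id v (fun _ => w)) y =
      covDerivAlong G' id u (covDerivAlong G' id v (fun _ => w)) y := by
    rw [covDerivAlong, (hcov v).fderiv_eq, (hcov v).eq_of_nhds, id, hΓ.eq_of_nhds]
    rfl
  simp only [riemannCoord, hcov₂]

variable {n d : ℕ} {M : Type*} [TopologicalSpace M] [ChartedSpace (EuclideanSpace ℝ (Fin n)) M]
  {N : Type*} [TopologicalSpace N] [ChartedSpace (EuclideanSpace ℝ (Fin d)) N]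
  [IsManifold (𝓡 d) ∞ N] {gN : Metric d N} {φ : M → N}

/-- `secondFund` as a bilinear map on the tangent space. -/
def secondFundForm (gN : Metric d N) (φ : M → N) (x : M) :
    TangentSpace (𝓡 n) x →ₗ[ℝ] TangentSpace (𝓡 n) x →ₗ[ℝ] TangentSpace (𝓡 d) (φ x) :=
  let h := secondFundCoord (chartMetric gN (φ x)) (writtenInExtChartAt (𝓡 n) (𝓡 d) x φ)
    (extChartAt (𝓡 n) x x)
  LinearMap.mk₂ ℝ (secondFund gN φ x) h.map_add₂ h.map_smul₂ (fun u => map_add (h u))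
    (fun a u => map_smul (h u) a)

theorem chartMetric_writtenInExtChartAt (gN : Metric d N) (φ : M → N) (x : M)
    (u v : TangentSpace (𝓡 d) (φ x)) :
    chartMetric gN (φ x) (writtenInExtChartAt (𝓡 n) (𝓡 d) x φ (extChartAt (𝓡 n) x x)) u v =
      gN.inner (φ x) u v := by
  rw [writtenInExtChartAt_self]
  exact chartMetric_self gN (φ x) u v

variable [IsManifold (𝓡 n) ∞ M] {g : Metric n M}

namespace IsIsometricImmersion

theorem inducedMetric_eq (h : IsIsometricImmersion g gN φ) (x : M)
    (u v : TangentSpace (𝓡 n) x) :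
    inducedMetric (chartMetric gN (φ x)) (writtenInExtChartAt (𝓡 n) (𝓡 d) x φ)
      (extChartAt (𝓡 n) x x) u v = g.inner x u v := by
  rw [← (h.chartMetric_eventuallyEq x).eq_of_nhds]
  exact chartMetric_self g x u v

theorem secondFundForm_symm (h : IsIsometricImmersion g gN φ) (x : M)
    (u v : TangentSpace (𝓡 n) x) : secondFundForm gN φ x u v = secondFundForm gN φ x v u :=
  (h.isImmersionNear x).secondFundCoord_symm u v

theorem inner_secondFundForm_mfderiv (h : IsIsometricImmersion g gN φ) (x : M)
    (u v w : TangentSpace (𝓡 n) x) :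
    gN.inner (φ x) (secondFundForm gN φ x u v) (mfderiv (𝓡 n) (𝓡 d) φ x w) = 0 := by
  have hnormal := (h.isImmersionNear x).inner_secondFundCoord_fderiv u v w
  rw [h.fderiv_writtenInExtChartAt] at hnormal
  exact (chartMetric_writtenInExtChartAt gN φ x _ _).symm.trans hnormal

theorem inner_shapeOperator (h : IsIsometricImmersion g gN φ) (x : M)
    (ξ : TangentSpace (𝓡 d) (φ x)) (u v : TangentSpace (𝓡 n) x) :
    g.inner x (shapeOperator gN φ x ξ u) v = gN.inner (φ x) (secondFundForm gN φ x u v) ξ :=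
  (h.inducedMetric_eq x _ _).symm.trans
    (((h.isImmersionNear x).inner_shapeCoord ξ u v).trans
      (chartMetric_writtenInExtChartAt gN φ x _ _))

theorem inner_riemann (h : IsIsometricImmersion g gN φ) (x : M)
    (u v w k : TangentSpace (𝓡 n) x) :
    g.inner x (riemann g x u v w) k =
      gN.inner (φ x) (riemann gN (φ x) (mfderiv (𝓡 n) (𝓡 d) φ x u) (mfderiv (𝓡 n) (𝓡 d) φ x v)
        (mfderiv (𝓡 n) (𝓡 d) φ x w)) (mfderiv (𝓡 n) (𝓡 d) φ x k) +
      gN.inner (φ x) (secondFundForm gN φ x v w) (secondFundForm gN φ x u k) -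
      gN.inner (φ x) (secondFundForm gN φ x u w) (secondFundForm gN φ x v k) := by
  have hgauss := (h.isImmersionNear x).gauss_equation u v w k
  have hR : riemann g x u v w = riemannCoord (inducedMetric (chartMetric gN (φ x))
      (writtenInExtChartAt (𝓡 n) (𝓡 d) x φ)) (extChartAt (𝓡 n) x x) u v w :=
    riemannCoord_congr (h.chartMetric_eventuallyEq x) u v w
  rw [h.fderiv_writtenInExtChartAt] at hgauss
  rw [hR]
  refine (h.inducedMetric_eq x _ _).symm.trans
    (hgauss.trans (congrArg₂ (· - ·) (congrArg₂ (· + ·) ?_ ?_) ?_))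
  · rw [writtenInExtChartAt_self]
    exact chartMetric_self gN (φ x) _ _
  · exact chartMetric_writtenInExtChartAt gN φ x _ _
  · exact chartMetric_writtenInExtChartAt gN φ x _ _

end IsIsometricImmersion

/-- All sectional curvatures of `(N, gN)` at the point `y` are equal to `c`. -/
def HasConstantCurvatureAt (gN : Metric d N) (y : N) (c : ℝ) : Prop :=
  ∀ u v : TangentSpace (𝓡 d) y, LinearIndependent ℝ ![u, v] → sectionalCurvature gN y u v = c

theorem HasConstantCurvatureAt.inner_riemann {y : N} {c : ℝ} (hc : HasConstantCurvatureAt gN y c)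
    (u v w z : TangentSpace (𝓡 d) y) :
    gN.inner y (riemann gN y u v w) z =
      c * (gN.inner y v w * gN.inner y u z - gN.inner y u w * gN.inner y v z) := by
  let : Bundle.RiemannianBundle (fun y : N => TangentSpace (𝓡 d) y) := ⟨gN.toRiemannianMetric⟩
  exact (isCurvatureLike_riemann gN y).eq_of_sectional_eq hc u v w z

theorem HasConstantCurvatureAt.riemann_eq_zero_of_inner_eq_zero {y : N} {c : ℝ}
    (hc : HasConstantCurvatureAt gN y c) {u v w : TangentSpace (𝓡 d) y}
    (hu : gN.inner y u w = 0) (hv : gN.inner y v w = 0) : riemann gN y u v w = 0 := by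
  by_contra hne
  refine (gN.pos y _ hne).ne' ?_
  rw [hc.inner_riemann, hu, hv]
  ring

theorem IsIsometricImmersion.normalFlatAt_of_secondFundForm_shapeOperator_comm
    (h : IsIsometricImmersion g gN φ) {x : M} {c : ℝ} (hc : HasConstantCurvatureAt gN (φ x) c)
    (hcomm : ∀ (ξ : TangentSpace (𝓡 d) (φ x)) (u v : TangentSpace (𝓡 n) x),
      secondFundForm gN φ x u (shapeOperator gN φ x ξ v) =
        secondFundForm gN φ x v (shapeOperator gN φ x ξ u)) :
    NormalFlatAt (n := n) gN φ x := by
  intro ξ hξ hnormal u v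
  have hI := h.isImmersionNear x
  rw [hI.ricci_equation (hξ.of_le ENat.LEInfty.out) hnormal]
  have hξx (u : EuclideanSpace ℝ (Fin n)) := (chartMetric_writtenInExtChartAt gN φ x _ _).symm.trans
    (hnormal.self_of_nhds u)
  have hR : riemannCoord (chartMetric gN (φ x))
      (writtenInExtChartAt (𝓡 n) (𝓡 d) x φ (extChartAt (𝓡 n) x x))
      (fderiv ℝ (writtenInExtChartAt (𝓡 n) (𝓡 d) x φ) (extChartAt (𝓡 n) x x) u)
      (fderiv ℝ (writtenInExtChartAt (𝓡 n) (𝓡 d) x φ) (extChartAt (𝓡 n) x x) v)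
      (ξ (extChartAt (𝓡 n) x x)) = 0 := by
    rw [writtenInExtChartAt_self]
    exact hc.riemann_eq_zero_of_inner_eq_zero (hξx u) (hξx v)
  rw [hR, map_zero, zero_add]
  exact sub_eq_zero.2 (hcomm _ u v)

end PointwiseEquations

section AdaptedFrames

open scoped RealInnerProductSpace
open Module

variable {V W : Type*} [NormedAddCommGroup V] [InnerProductSpace ℝ V]
  [NormedAddCommGroup W] [InnerProductSpace ℝ W]

theorem exists_norm_eq_one_eq_smul [Nontrivial V] (η : V) :
    ∃ (w : V) (c : ℝ), ‖w‖ = 1 ∧ η = c • w := by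
  rcases eq_or_ne η 0 with rfl | hη
  · obtain ⟨w, hw⟩ := exists_norm_eq V zero_le_one
    exact ⟨w, 0, hw, (zero_smul ℝ w).symm⟩
  · exact ⟨‖η‖⁻¹ • η, ‖η‖, norm_smul_inv_norm hη,
      (smul_inv_smul₀ (norm_ne_zero_iff.2 hη) η).symm⟩

theorem inner_idealForm_orthonormalBasis {n : ℕ} (e : OrthonormalBasis (Fin n) ℝ V) {k : Fin n}
    (hk : (k : ℕ) + 1 = n) (η ξ : W) (i j : Fin n) :
    ⟪idealForm (e k) η (e j) (e i), ξ⟫ =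
      Matrix.diagonal (fun i : Fin n => if (i : ℕ) + 1 = n then ⟪η, ξ⟫ else 2 * ⟪η, ξ⟫) i j := by
  have he := orthonormal_iff_ite.1 e.orthonormal
  rw [idealForm_apply, real_inner_smul_left, he, he, he, Matrix.diagonal_apply]
  rcases eq_or_ne i j with rfl | hij
  · by_cases hi : (i : ℕ) + 1 = n
    · obtain rfl : i = k := Fin.ext (by omega)
      simp only [if_true, hi]; ring
    · have : i ≠ k := fun h => hi (h ▸ hk)
      simp [this, hi]
  · have : ¬(j = k ∧ i = k) := fun h => hij (h.2.trans h.1.symm)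
    grind

theorem isIdealForm_of_inner_orthonormalBases {n p : ℕ} (hn : 0 < n) {P : Submodule ℝ W}
    {h : V →ₗ[ℝ] V →ₗ[ℝ] W} (hh : ∀ u v, h u v ∈ P) (e : OrthonormalBasis (Fin n) ℝ V)
    (b : OrthonormalBasis (Fin p) ℝ P) {lam : ℝ}
    (hdiag : ∀ r : Fin p, Matrix.of (fun i j => ⟪h (e j) (e i), (b r : W)⟫) =
      if (r : ℕ) = 0 then
        Matrix.diagonal (fun i : Fin n => if (i : ℕ) + 1 = n then lam else 2 * lam)
      else 0) :
    IsIdealForm h := by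
  obtain ⟨k, rfl⟩ : ∃ k, n = k + 1 := ⟨n - 1, by omega⟩
  obtain ⟨η, hη⟩ : ∃ η : P, ∀ r, ⟪(η : W), (b r : W)⟫ = if (r : ℕ) = 0 then lam else 0 :=
    ⟨∑ r : Fin p, (if (r : ℕ) = 0 then lam else 0) • b r,
      fun r => b.orthonormal.inner_left_fintype _ r⟩
  refine ⟨e (Fin.last k), η, e.orthonormal.1 _, ?_⟩
  have hmem : ∀ u v, idealForm (e (Fin.last k)) (η : W) u v ∈ P := fun u v =>
    idealForm_apply (e (Fin.last k)) (η : W) u v ▸ P.smul_mem _ η.2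
  refine e.toBasis.ext fun j => e.toBasis.ext fun i => ?_
  suffices (⟨h (e j) (e i), hh _ _⟩ : P) = ⟨_, hmem (e j) (e i)⟩ by
    simpa only [e.coe_toBasis] using congrArg Subtype.val this
  refine InnerProductSpace.ext_inner_right_basis b.toBasis fun r => ?_
  rw [b.coe_toBasis, Submodule.coe_inner, Submodule.coe_inner,
    inner_idealForm_orthonormalBasis e rfl, hη]
  refine (congrFun₂ (hdiag r) i j).trans ?_
  split_ifs with hr
  · rfl
  · simp [Matrix.diagonal_apply]

variable [FiniteDimensional ℝ V]

theorem exists_orthonormalBasis_coe_eq {ι : Type*} [Fintype ι] {e : ι → V}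
    (hι : finrank ℝ V = Fintype.card ι) (he : Orthonormal ℝ e) :
    ∃ b : OrthonormalBasis ι ℝ V, ⇑b = e := by
  obtain ⟨b, hb⟩ := Orthonormal.exists_orthonormalBasis_extension_of_card_eq hι (v := e)
    (s := Set.univ) (he.comp _ Subtype.val_injective)
  exact ⟨b, funext fun i => hb i (Set.mem_univ i)⟩

theorem exists_orthonormalBasis_apply_eq {ι : Type*} [Fintype ι] {ν : V}
    (hι : finrank ℝ V = Fintype.card ι) (hν : ‖ν‖ = 1) (k : ι) :
    ∃ b : OrthonormalBasis ι ℝ V, b k = ν := by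
  obtain ⟨b, hb⟩ := Orthonormal.exists_orthonormalBasis_extension_of_card_eq hι (v := fun _ => ν)
    (s := {k}) (orthonormal_subsingleton_iff.2 fun _ => hν)
  exact ⟨b, hb k rfl⟩

theorem exists_orthonormalBasis_inner_eq_ite {p : ℕ} (hp : finrank ℝ V = p) (η : V) :
    ∃ (b : OrthonormalBasis (Fin p) ℝ V) (c : ℝ),
      ∀ r : Fin p, ⟪η, b r⟫ = if (r : ℕ) = 0 then c else 0 := by
  cases p with
  | zero => exact ⟨(stdOrthonormalBasis ℝ V).reindex (finCongr hp), 0, fun r => r.elim0⟩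
  | succ k =>
    have : Nontrivial V := nontrivial_of_finrank_eq_succ hp
    obtain ⟨w, c, hw, rfl⟩ := exists_norm_eq_one_eq_smul η
    obtain ⟨b, rfl⟩ := exists_orthonormalBasis_apply_eq (hp.trans (Fintype.card_fin _).symm) hw 0
    refine ⟨b, c, fun r => ?_⟩
    rw [real_inner_smul_left, orthonormal_iff_ite.1 b.orthonormal, mul_ite, mul_one, mul_zero]
    simp only [Fin.ext_iff, Fin.val_zero, @eq_comm ℕ 0]

theorem exists_orthonormalBases_inner_idealForm {n p : ℕ} (hn : 0 < n) (hV : finrank ℝ V = n)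
    {P : Submodule ℝ W} [FiniteDimensional ℝ P] (hP : finrank ℝ P = p) {ν : V} {η : W}
    (hν : ‖ν‖ = 1) (hη : η ∈ P) :
    ∃ (e : OrthonormalBasis (Fin n) ℝ V) (b : OrthonormalBasis (Fin p) ℝ P) (lam : ℝ),
      ∀ r : Fin p, Matrix.of (fun i j => ⟪idealForm ν η (e j) (e i), (b r : W)⟫) =
        if (r : ℕ) = 0 then
          Matrix.diagonal (fun i : Fin n => if (i : ℕ) + 1 = n then lam else 2 * lam)
        else 0 := by
  obtain ⟨k, rfl⟩ : ∃ k, n = k + 1 := ⟨n - 1, by omega⟩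
  obtain ⟨e, rfl⟩ := exists_orthonormalBasis_apply_eq (hV.trans (Fintype.card_fin _).symm) hν
    (Fin.last k)
  obtain ⟨b, lam, hb⟩ := exists_orthonormalBasis_inner_eq_ite hP ⟨η, hη⟩
  refine ⟨e, b, lam, fun r => Matrix.ext fun i j => ?_⟩
  have hbr : ⟪η, (b r : W)⟫ = if (r : ℕ) = 0 then lam else 0 := hb r
  rw [Matrix.of_apply, inner_idealForm_orthonormalBasis e rfl, hbr]
  split_ifs with hr
  · rfl
  · simp [Matrix.diagonal_apply]

end AdaptedFrames

section CasoratiCurvature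

open scoped RealInnerProductSpace Bundle
open Bundle Module

theorem two_mul_sum_ite_lt {ι : Type*} [Fintype ι] [LinearOrder ι] {a : ι → ι → ℝ}
    (hsymm : ∀ i j, a i j = a j i) (hdiag : ∀ i, a i i = 0) :
    2 * ∑ i, ∑ j, (if i < j then a i j else 0) = ∑ i, ∑ j, a i j := by
  have hsplit : ∀ i j, a i j = (if i < j then a i j else 0) + if j < i then a j i else 0 := by
    intro i j
    rcases lt_trichotomy i j with hij | rfl | hij
    · simp [hij, hij.not_gt]
    · simp [hdiag]
    · simp [hij, hij.not_gt, hsymm i j]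
  calc 2 * ∑ i, ∑ j, (if i < j then a i j else 0)
    _ = (∑ i, ∑ j, if i < j then a i j else 0) + ∑ i, ∑ j, if j < i then a j i else 0 := by
      rw [two_mul, Finset.sum_comm (f := fun i j => if j < i then a j i else 0)]
    _ = ∑ i, ∑ j, a i j := by
      simp only [← Finset.sum_add_distrib, ← hsplit]

variable {n d : ℕ} {M : Type*} [TopologicalSpace M] [ChartedSpace (EuclideanSpace ℝ (Fin n)) M]
  {N : Type*} [TopologicalSpace N] [ChartedSpace (EuclideanSpace ℝ (Fin d)) N]

instance finiteDimensional_tangentSpace (x : M) : FiniteDimensional ℝ (TangentSpace (𝓡 n) x) :=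
  inferInstanceAs (FiniteDimensional ℝ (EuclideanSpace ℝ (Fin n)))

theorem finrank_tangentSpace (x : M) : finrank ℝ (TangentSpace (𝓡 n) x) = n :=
  finrank_euclideanSpace_fin

variable [IsManifold (𝓡 n) ∞ M] [IsManifold (𝓡 d) ∞ N]
  {g : Metric n M} {gN : Metric d N} {φ : M → N}

theorem isOrthonormal_frame (g : Metric n M) (x : M) (L : Submodule ℝ (TangentSpace (𝓡 n) x)) :
    IsOrthonormal (fun u v => g.inner x u v) (frame g x L) :=
  (exists_frame g x L).choose_spec.1

theorem frame_mem (g : Metric n M) (x : M) (L : Submodule ℝ (TangentSpace (𝓡 n) x))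
    (i : Fin (finrank ℝ L)) : frame g x L i ∈ L :=
  (exists_frame g x L).choose_spec.2.le (Submodule.subset_span ⟨i, rfl⟩)

theorem two_mul_scalarCurvature (g : Metric n M) (x : M) :
    2 * scalarCurvature g x = ∑ i, ∑ j, g.inner x (riemann g x (frame g x ⊤ i) (frame g x ⊤ j)
      (frame g x ⊤ j)) (frame g x ⊤ i) := by
  have hR := isCurvatureLike_riemann g x
  have he : ∀ i j, g.inner x (frame g x ⊤ i) (frame g x ⊤ j) = if i = j then 1 else 0 :=
    isOrthonormal_frame g x ⊤
  refine Eq.trans (congrArg (2 * ·) ?_) (two_mul_sum_ite_lt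
    (fun i j => hR.pair_symm _ _ _ _) (fun i => self_eq_neg.1 (hR.swap_left _ _ _ _)))
  refine Finset.sum_congr rfl fun i _ => Finset.sum_congr rfl fun j _ => ?_
  split_ifs with hij
  · rw [sectionalCurvature, he, he, he, if_pos rfl, if_pos rfl, if_neg hij.ne]
    norm_num
  · rfl

variable [RiemannianBundle (fun x : M => TangentSpace (𝓡 n) x)]

theorem isOrthonormal_iff (hg : ∀ (x : M) (u v : TangentSpace (𝓡 n) x), g.inner x u v = ⟪u, v⟫)
    {x : M} {ι : Type*} [DecidableEq ι] {e : ι → TangentSpace (𝓡 n) x} :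
    IsOrthonormal (fun u v => g.inner x u v) e ↔ Orthonormal ℝ e := by
  simp only [IsOrthonormal, hg, orthonormal_iff_ite]

theorem exists_orthonormalBasis_frame
    (hg : ∀ (x : M) (u v : TangentSpace (𝓡 n) x), g.inner x u v = ⟪u, v⟫) (x : M)
    (L : Submodule ℝ (TangentSpace (𝓡 n) x)) :
    ∃ b : OrthonormalBasis (Fin (finrank ℝ L)) ℝ L, ∀ i, (b i : TangentSpace (𝓡 n) x) =
      frame g x L i := by
  obtain ⟨b, hb⟩ := exists_orthonormalBasis_coe_eq (Fintype.card_fin _).symm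
    (((isOrthonormal_iff hg).1 (isOrthonormal_frame g x L)).codRestrict L (frame_mem g x L))
  exact ⟨b, fun i => by rw [hb]; rfl⟩

theorem exists_orthonormalBasis_frame_top
    (hg : ∀ (x : M) (u v : TangentSpace (𝓡 n) x), g.inner x u v = ⟪u, v⟫) (x : M) :
    ∃ b : OrthonormalBasis (Fin (finrank ℝ (⊤ : Submodule ℝ (TangentSpace (𝓡 n) x)))) ℝ
      (TangentSpace (𝓡 n) x), ⇑b = frame g x ⊤ :=
  exists_orthonormalBasis_coe_eq (by rw [Fintype.card_fin, finrank_top])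
    ((isOrthonormal_iff hg).1 (isOrthonormal_frame g x ⊤))

variable [RiemannianBundle (fun y : N => TangentSpace (𝓡 d) y)]

theorem casoratiOn_eq (hg : ∀ (x : M) (u v : TangentSpace (𝓡 n) x), g.inner x u v = ⟪u, v⟫)
    (hgN : ∀ (y : N) (u v : TangentSpace (𝓡 d) y), gN.inner y u v = ⟪u, v⟫) (φ : M → N) (x : M)
    (L : Submodule ℝ (TangentSpace (𝓡 n) x)) :
    casoratiOn g gN φ x L =
      (1 / finrank ℝ L) * formNormSq ((secondFundForm gN φ x).domRestrict₁₂ L L) := by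
  obtain ⟨b, hb⟩ := exists_orthonormalBasis_frame hg x L
  simp only [casoratiOn, formNormSq_eq_sum _ b, LinearMap.domRestrict₁₂_apply, hb, hgN,
    real_inner_self_eq_norm_sq]
  rfl

theorem casorati_eq (hg : ∀ (x : M) (u v : TangentSpace (𝓡 n) x), g.inner x u v = ⟪u, v⟫)
    (hgN : ∀ (y : N) (u v : TangentSpace (𝓡 d) y), gN.inner y u v = ⟪u, v⟫) (φ : M → N) (x : M) :
    casorati g gN φ x = (1 / n) * formNormSq (secondFundForm (n := n) gN φ x) := by
  obtain ⟨b, hb⟩ := exists_orthonormalBasis_frame_top hg x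
  simp only [casorati, casoratiOn, formNormSq_eq_sum _ b, hb, hgN, real_inner_self_eq_norm_sq,
    finrank_top, finrank_tangentSpace]
  rfl

theorem deltaHat_eq (hg : ∀ (x : M) (u v : TangentSpace (𝓡 n) x), g.inner x u v = ⟪u, v⟫)
    (hgN : ∀ (y : N) (u v : TangentSpace (𝓡 d) y), gN.inner y u v = ⟪u, v⟫) (hn : 2 ≤ n)
    (φ : M → N) {x : M} {L : Submodule ℝ (TangentSpace (𝓡 n) x)} (hL : finrank ℝ L + 1 = n)
    (hmax : ∀ L' : Submodule ℝ (TangentSpace (𝓡 n) x), finrank ℝ L' + 1 = n →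
      formNormSq ((secondFundForm gN φ x).domRestrict₁₂ L' L') ≤
        formNormSq ((secondFundForm gN φ x).domRestrict₁₂ L L)) :
    n * (n - 1) * deltaHat g gN φ x = (2 * n - 1) * weightedNormSq (secondFundForm gN φ x) L -
      formNormSq (secondFundForm (n := n) gN φ x) := by
  have hsup : IsGreatest {C : ℝ | ∃ L : Submodule ℝ (TangentSpace (𝓡 n) x),
      finrank ℝ L + 1 = n ∧ C = casoratiOn g gN φ x L} (casoratiOn g gN φ x L) := by
    refine ⟨⟨L, hL, rfl⟩, ?_⟩
    rintro _ ⟨L', hL', rfl⟩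
    rw [casoratiOn_eq hg hgN, casoratiOn_eq hg hgN, show finrank ℝ L' = finrank ℝ L by omega]
    exact mul_le_mul_of_nonneg_left (hmax L' hL') (by positivity)
  have hn₁ : (finrank ℝ L : ℝ) = n - 1 := eq_sub_of_add_eq (mod_cast hL)
  have hn₂ : (2 : ℝ) ≤ n := mod_cast hn
  have hn₃ : (n : ℝ) - 1 ≠ 0 := by linarith
  rw [deltaHat, hsup.csSup_eq, casorati_eq hg hgN, casoratiOn_eq hg hgN, hn₁, weightedNormSq]
  field

theorem IsIsometricImmersion.two_mul_scalarCurvature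
    (hg : ∀ (x : M) (u v : TangentSpace (𝓡 n) x), g.inner x u v = ⟪u, v⟫)
    (hgN : ∀ (y : N) (u v : TangentSpace (𝓡 d) y), gN.inner y u v = ⟪u, v⟫)
    (h : IsIsometricImmersion g gN φ) {x : M} {c : ℝ} (hc : HasConstantCurvatureAt gN (φ x) c) :
    2 * scalarCurvature g x = n * (n - 1) * c + ‖formTrace (secondFundForm (n := n) gN φ x)‖ ^ 2 -
      formNormSq (secondFundForm (n := n) gN φ x) := by
  obtain ⟨e, he⟩ := exists_orthonormalBasis_frame_top hg x
  have hK : ∀ i j, g.inner x (riemann g x (e i) (e j) (e j)) (e i) =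
      c * (1 - if i = j then 1 else 0) +
        ⟪secondFundForm gN φ x (e j) (e j), secondFundForm gN φ x (e i) (e i)⟫ -
        ‖secondFundForm gN φ x (e i) (e j)‖ ^ 2 := by
    intro i j
    rw [h.inner_riemann, hc.inner_riemann, h.isometric, h.isometric, h.isometric, h.isometric,
      h.secondFundForm_symm x (e j) (e i), hg, hg, hg, hg, hgN, hgN,
      ← real_inner_self_eq_norm_sq (secondFundForm gN φ x (e i) (e j))]
    simp only [orthonormal_iff_ite.1 e.orthonormal, if_true, eq_comm (a := j)]
    split_ifs <;> ring
  rw [Casorati.two_mul_scalarCurvature, ← he, formNormSq_eq_sum _ e, formTrace_eq_sum _ e,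
    ← real_inner_self_eq_norm_sq]
  simp only [hK, Finset.sum_sub_distrib, Finset.sum_add_distrib, ← Finset.mul_sum, sum_inner,
    inner_sum, Finset.sum_ite_eq, Finset.mem_univ, if_true, Finset.sum_const, Finset.card_univ,
    Fintype.card_fin, nsmul_eq_mul, mul_one, finrank_top, finrank_tangentSpace]
  ring

theorem IsIsometricImmersion.deltaHat_add_sub_normalizedScalarCurvature
    (hg : ∀ (x : M) (u v : TangentSpace (𝓡 n) x), g.inner x u v = ⟪u, v⟫)
    (hgN : ∀ (y : N) (u v : TangentSpace (𝓡 d) y), gN.inner y u v = ⟪u, v⟫)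
    (h : IsIsometricImmersion g gN φ) (hn : 2 ≤ n) {x : M} {c : ℝ}
    (hc : HasConstantCurvatureAt gN (φ x) c)
    {L : Submodule ℝ (TangentSpace (𝓡 n) x)} (hL : finrank ℝ L + 1 = n)
    (hmax : ∀ L' : Submodule ℝ (TangentSpace (𝓡 n) x), finrank ℝ L' + 1 = n →
      formNormSq ((secondFundForm gN φ x).domRestrict₁₂ L' L') ≤
        formNormSq ((secondFundForm gN φ x).domRestrict₁₂ L L)) :
    n * (n - 1) * (deltaHat g gN φ x + c - normalizedScalarCurvature g x) =
      (2 * n - 1) * weightedNormSq (secondFundForm gN φ x) L -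
        ‖formTrace (secondFundForm (n := n) gN φ x)‖ ^ 2 := by
  have hn₁ : (2 : ℝ) ≤ n := mod_cast hn
  have hn₂ : (n * (n - 1) : ℝ) ≠ 0 := mul_ne_zero (by linarith) (by linarith)
  rw [normalizedScalarCurvature, h.two_mul_scalarCurvature hg hgN hc, mul_sub, mul_add,
    deltaHat_eq hg hgN hn φ hL hmax, mul_div_cancel₀ _ hn₂]
  ring

theorem IsIsometricImmersion.normalizedScalarCurvature_le_and_eq_iff
    (hg : ∀ (x : M) (u v : TangentSpace (𝓡 n) x), g.inner x u v = ⟪u, v⟫)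
    (hgN : ∀ (y : N) (u v : TangentSpace (𝓡 d) y), gN.inner y u v = ⟪u, v⟫)
    (h : IsIsometricImmersion g gN φ) (hn : 2 ≤ n) {x : M} {c : ℝ}
    (hc : HasConstantCurvatureAt gN (φ x) c) :
    normalizedScalarCurvature g x ≤ deltaHat g gN φ x + c ∧
      (normalizedScalarCurvature g x = deltaHat g gN φ x + c ↔
        IsIdealForm (secondFundForm (n := n) gN φ x)) := by
  have hdim := finrank_tangentSpace (n := n) x
  have : Nontrivial (TangentSpace (𝓡 n) x) :=
    nontrivial_of_finrank_pos (R := ℝ) (by rw [hdim]; omega)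
  have hs := h.secondFundForm_symm x
  obtain ⟨L, hL, hmax⟩ := exists_hyperplane_formNormSq_max hs
  obtain ⟨ν, hν⟩ := exists_isUnitNormal hL
  have hle := norm_formTrace_sq_le hs hν
  have hiff := norm_formTrace_sq_eq_iff hs hL hmax
  rw [hdim] at hL hle hiff hmax
  have hgap := h.deltaHat_add_sub_normalizedScalarCurvature hg hgN hn hc hL hmax
  have hn₁ : (2 : ℝ) ≤ n := mod_cast hn
  have hpos : (0 : ℝ) < n * (n - 1) := mul_pos (by linarith) (by linarith)
  refine ⟨sub_nonneg.1 (nonneg_of_mul_nonneg_right (hgap ▸ sub_nonneg.2 hle) hpos), ?_⟩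
  rw [← hiff, eq_comm, ← sub_eq_zero, ← mul_eq_zero_iff_left hpos.ne', hgap, sub_eq_zero, eq_comm]

end CasoratiCurvature

section IdealPoints

open scoped RealInnerProductSpace Bundle
open Bundle Module

variable {n d : ℕ} {M : Type*} [TopologicalSpace M] [ChartedSpace (EuclideanSpace ℝ (Fin n)) M]
  {N : Type*} [TopologicalSpace N] [ChartedSpace (EuclideanSpace ℝ (Fin d)) N]
  [RiemannianBundle (fun y : N => TangentSpace (𝓡 d) y)] {φ : M → N} {x : M}

/-- The normal space of `φ` at `x`. -/
def normalSpace (n d : ℕ) {M : Type*} [TopologicalSpace M]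
    [ChartedSpace (EuclideanSpace ℝ (Fin n)) M] {N : Type*} [TopologicalSpace N]
    [ChartedSpace (EuclideanSpace ℝ (Fin d)) N]
    [RiemannianBundle (fun y : N => TangentSpace (𝓡 d) y)] (φ : M → N) (x : M) :
    Submodule ℝ (TangentSpace (𝓡 d) (φ x)) :=
  (mfderiv (𝓡 n) (𝓡 d) φ x).rangeᗮ

theorem mem_normalSpace {ξ : TangentSpace (𝓡 d) (φ x)} :
    ξ ∈ normalSpace n d φ x ↔
      ∀ u : TangentSpace (𝓡 n) x, ⟪mfderiv (𝓡 n) (𝓡 d) φ x u, ξ⟫ = 0 := by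
  simp [normalSpace, Submodule.mem_orthogonal]

variable [IsManifold (𝓡 n) ∞ M] [IsManifold (𝓡 d) ∞ N] {g : Metric n M} {gN : Metric d N}

namespace IsIsometricImmersion

theorem finrank_normalSpace (h : IsIsometricImmersion g gN φ) (x : M) :
    n + finrank ℝ (normalSpace n d φ x) = d := by
  have hinj : Function.Injective (mfderiv (𝓡 n) (𝓡 d) φ x) := by
    refine (injective_iff_map_eq_zero _).2 fun u hu => by_contra fun hne => (g.pos x u hne).ne' ?_
    rw [← h.isometric, hu, map_zero]
  have hrange := (mfderiv (𝓡 n) (𝓡 d) φ x).range.finrank_add_finrank_orthogonal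
  rwa [LinearMap.finrank_range_of_inj hinj, finrank_tangentSpace, finrank_tangentSpace] at hrange

theorem isNormalFrame_iff_exists_orthonormalBasis
    (hgN : ∀ (y : N) (u v : TangentSpace (𝓡 d) y), gN.inner y u v = ⟪u, v⟫)
    (h : IsIsometricImmersion g gN φ) {p : ℕ} (hd : n + p = d)
    {ξ : Fin p → TangentSpace (𝓡 d) (φ x)} :
    IsNormalFrame (n := n) gN φ x ξ ↔
      ∃ b : OrthonormalBasis (Fin p) ℝ (normalSpace n d φ x), ∀ r, b r = ξ r := by
  rw [IsNormalFrame, isOrthonormal_iff hgN]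
  simp only [hgN, ← mem_normalSpace]
  constructor
  · rintro ⟨hξ, hmem⟩
    have hp : finrank ℝ (normalSpace n d φ x) = Fintype.card (Fin p) := by
      have := h.finrank_normalSpace x
      rw [Fintype.card_fin]
      omega
    obtain ⟨b, hb⟩ := exists_orthonormalBasis_coe_eq hp (hξ.codRestrict _ hmem)
    exact ⟨b, fun r => by rw [hb]; rfl⟩
  · rintro ⟨b, hb⟩
    obtain rfl : (fun r => (b r : TangentSpace (𝓡 d) (φ x))) = ξ := funext hb
    exact ⟨b.orthonormal.comp_linearIsometry (normalSpace n d φ x).subtypeₗᵢ,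
      fun r => (b r).2⟩

theorem secondFundForm_mem_normalSpace
    (hgN : ∀ (y : N) (u v : TangentSpace (𝓡 d) y), gN.inner y u v = ⟪u, v⟫)
    (h : IsIsometricImmersion g gN φ) (u v : TangentSpace (𝓡 n) x) :
    secondFundForm gN φ x u v ∈ normalSpace n d φ x :=
  mem_normalSpace.2 fun w => by
    rw [real_inner_comm, ← hgN, h.inner_secondFundForm_mfderiv]

theorem shapeMatrix_eq_of_inner
    (hgN : ∀ (y : N) (u v : TangentSpace (𝓡 d) y), gN.inner y u v = ⟪u, v⟫)
    (h : IsIsometricImmersion g gN φ) (e : Fin n → TangentSpace (𝓡 n) x)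
    (ξ : TangentSpace (𝓡 d) (φ x)) :
    shapeMatrix g gN φ x e ξ =
      Matrix.of fun i j => ⟪secondFundForm gN φ x (e j) (e i), ξ⟫ := by
  ext i j
  rw [Matrix.of_apply, ← hgN, ← h.inner_shapeOperator]
  rfl

end IsIsometricImmersion

variable [RiemannianBundle (fun x : M => TangentSpace (𝓡 n) x)]

namespace IsIsometricImmersion

theorem shapeOperator_eq_of_secondFundForm_eq
    (hg : ∀ (x : M) (u v : TangentSpace (𝓡 n) x), g.inner x u v = ⟪u, v⟫)
    (hgN : ∀ (y : N) (u v : TangentSpace (𝓡 d) y), gN.inner y u v = ⟪u, v⟫)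
    (h : IsIsometricImmersion g gN φ) {ν : TangentSpace (𝓡 n) x} {η : TangentSpace (𝓡 d) (φ x)}
    (hideal : secondFundForm gN φ x = idealForm ν η) (ξ : TangentSpace (𝓡 d) (φ x))
    (u : TangentSpace (𝓡 n) x) :
    shapeOperator gN φ x ξ u = ⟪η, ξ⟫ • ((2 : ℝ) • u - ⟪u, ν⟫ • ν) := by
  refine ext_inner_right ℝ fun v => ?_
  rw [← hg, h.inner_shapeOperator, hideal, idealForm_apply, hgN, real_inner_smul_left,
    real_inner_smul_left, inner_sub_left, real_inner_smul_left, real_inner_smul_left,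
    real_inner_comm v ν, mul_comm]

theorem invariantlyQuasiUmbilicalAt_of_secondFundForm_eq
    (hg : ∀ (x : M) (u v : TangentSpace (𝓡 n) x), g.inner x u v = ⟪u, v⟫)
    (hgN : ∀ (y : N) (u v : TangentSpace (𝓡 d) y), gN.inner y u v = ⟪u, v⟫)
    (h : IsIsometricImmersion g gN φ) {ν : TangentSpace (𝓡 n) x} {η : TangentSpace (𝓡 d) (φ x)}
    (hν : ‖ν‖ = 1) (hideal : secondFundForm gN φ x = idealForm ν η) {p : ℕ}
    {ξ : Fin p → TangentSpace (𝓡 d) (φ x)} (hξ : IsNormalFrame (n := n) gN φ x ξ) :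
    InvariantlyQuasiUmbilicalAt p g gN φ x := by
  refine ⟨ξ, hξ, ν, norm_ne_zero_iff.1 (hν ▸ one_ne_zero),
    fun r => ⟨⟪η, ξ r⟫ * 2, ⟪η, ξ r⟫, ?_, fun v hv => ?_⟩⟩
  · rw [h.shapeOperator_eq_of_secondFundForm_eq hg hgN hideal, real_inner_self_eq_norm_sq, hν]
    module
  · rw [hg] at hv
    rw [h.shapeOperator_eq_of_secondFundForm_eq hg hgN hideal, hv, zero_smul, sub_zero, smul_smul]

theorem normalFlatAt_of_secondFundForm_eq
    (hg : ∀ (x : M) (u v : TangentSpace (𝓡 n) x), g.inner x u v = ⟪u, v⟫)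
    (hgN : ∀ (y : N) (u v : TangentSpace (𝓡 d) y), gN.inner y u v = ⟪u, v⟫)
    (h : IsIsometricImmersion g gN φ) {c : ℝ} (hc : HasConstantCurvatureAt gN (φ x) c)
    {ν : TangentSpace (𝓡 n) x} {η : TangentSpace (𝓡 d) (φ x)}
    (hideal : secondFundForm gN φ x = idealForm ν η) : NormalFlatAt (n := n) gN φ x := by
  refine h.normalFlatAt_of_secondFundForm_shapeOperator_comm hc fun ξ u v => ?_
  simp only [h.shapeOperator_eq_of_secondFundForm_eq hg hgN hideal, hideal, idealForm_apply,
    inner_sub_left, inner_sub_right, real_inner_smul_left, real_inner_smul_right]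
  rw [real_inner_comm u v]
  module

theorem idealShapeAt_of_secondFundForm_eq
    (hg : ∀ (x : M) (u v : TangentSpace (𝓡 n) x), g.inner x u v = ⟪u, v⟫)
    (hgN : ∀ (y : N) (u v : TangentSpace (𝓡 d) y), gN.inner y u v = ⟪u, v⟫)
    (h : IsIsometricImmersion g gN φ) {p : ℕ} (hn : 0 < n) (hd : n + p = d)
    {ν : TangentSpace (𝓡 n) x} {η : TangentSpace (𝓡 d) (φ x)} (hν : ‖ν‖ = 1)
    (hideal : secondFundForm gN φ x = idealForm ν η) : IdealShapeAt p g gN φ x := by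
  have hη : η ∈ normalSpace n d φ x := by
    have hνν : secondFundForm gN φ x ν ν = η := by
      rw [hideal, idealForm_apply, real_inner_self_eq_norm_sq, hν]
      module
    exact hνν ▸ h.secondFundForm_mem_normalSpace hgN ν ν
  obtain ⟨e, b, lam, hb⟩ := exists_orthonormalBases_inner_idealForm
    (V := TangentSpace (𝓡 n) x) (W := TangentSpace (𝓡 d) (φ x)) hn (finrank_tangentSpace x)
    (Nat.add_left_cancel ((h.finrank_normalSpace x).trans hd.symm)) hν hη
  refine ⟨e, fun r => b r, lam, (isOrthonormal_iff hg).2 e.orthonormal,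
    (h.isNormalFrame_iff_exists_orthonormalBasis hgN hd).2 ⟨b, fun _ => rfl⟩, fun r => ?_⟩
  rw [h.shapeMatrix_eq_of_inner hgN, hideal]
  exact hb r

theorem isIdealForm_of_idealShapeAt
    (hg : ∀ (x : M) (u v : TangentSpace (𝓡 n) x), g.inner x u v = ⟪u, v⟫)
    (hgN : ∀ (y : N) (u v : TangentSpace (𝓡 d) y), gN.inner y u v = ⟪u, v⟫)
    (h : IsIsometricImmersion g gN φ) {p : ℕ} (hn : 0 < n) (hd : n + p = d)
    (hshape : IdealShapeAt p g gN φ x) : IsIdealForm (secondFundForm (n := n) gN φ x) := by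
  obtain ⟨e, ξ, lam, he, hξ, hA⟩ := hshape
  obtain ⟨e, rfl⟩ := exists_orthonormalBasis_coe_eq (V := TangentSpace (𝓡 n) x)
    ((finrank_tangentSpace x).trans (Fintype.card_fin n).symm) ((isOrthonormal_iff hg).1 he)
  obtain ⟨b, hb⟩ := (h.isNormalFrame_iff_exists_orthonormalBasis hgN hd).1 hξ
  refine isIdealForm_of_inner_orthonormalBases (V := TangentSpace (𝓡 n) x)
    (W := TangentSpace (𝓡 d) (φ x)) (lam := lam) hn
    (h.secondFundForm_mem_normalSpace hgN) e b fun r => ?_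
  rw [← hA, h.shapeMatrix_eq_of_inner hgN, hb]

end IsIsometricImmersion

end IdealPoints

end Casorati

end

open Casorati Bundle RealInnerProductSpace in
theorem theorem1p1_general (n p : ℕ) (hn : 2 ≤ n) (c : ℝ)
    {M : Type*} [TopologicalSpace M] [ChartedSpace (EuclideanSpace ℝ (Fin n)) M]
    [IsManifold (𝓡 n) ∞ M]
    {N : Type*} [TopologicalSpace N] [ChartedSpace (EuclideanSpace ℝ (Fin (n + p))) N]
    [IsManifold (𝓡 (n + p)) ∞ N]
    (g : Metric n M) (gN : Metric (n + p) N) (φ : M → N) (hφ : IsIsometricImmersion g gN φ)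
    (x : M) (hc : HasConstantCurvatureAt gN (φ x) c) :
    normalizedScalarCurvature g x ≤ deltaHat g gN φ x + c ∧
    (normalizedScalarCurvature g x = deltaHat g gN φ x + c ↔
      InvariantlyQuasiUmbilicalAt p g gN φ x ∧
      NormalFlatAt (n := n) gN φ x ∧
      IdealShapeAt p g gN φ x) := by
  let : RiemannianBundle (fun x : M => TangentSpace (𝓡 n) x) := ⟨g.toRiemannianMetric⟩
  let : RiemannianBundle (fun y : N => TangentSpace (𝓡 (n + p)) y) := ⟨gN.toRiemannianMetric⟩
  have hg : ∀ (x : M) (u v : TangentSpace (𝓡 n) x), g.inner x u v = ⟪u, v⟫ := fun _ _ _ => rfl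
  have hgN : ∀ (y : N) (u v : TangentSpace (𝓡 (n + p)) y), gN.inner y u v = ⟪u, v⟫ :=
    fun _ _ _ => rfl
  obtain ⟨hle, heq⟩ := hφ.normalizedScalarCurvature_le_and_eq_iff hg hgN hn hc
  refine ⟨hle, heq.trans ⟨?_, fun hx =>
    hφ.isIdealForm_of_idealShapeAt hg hgN (by omega) rfl hx.2.2⟩⟩
  rintro ⟨ν, η, hν, hideal⟩
  have hshape := hφ.idealShapeAt_of_secondFundForm_eq hg hgN (by omega) rfl hν hideal
  have ⟨_, _, _, _, hξ, _⟩ := hshape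
  exact ⟨hφ.invariantlyQuasiUmbilicalAt_of_secondFundForm_eq hg hgN hν hideal hξ,
    hφ.normalFlatAt_of_secondFundForm_eq hg hgN hc hideal, hshape⟩

theorem theorem1p1 (n p : ℕ) (hn : 2 ≤ n) (c : ℝ)
    {M : Type*} [TopologicalSpace M] [ChartedSpace (EuclideanSpace ℝ (Fin n)) M]
    [IsManifold (𝓡 n) ∞ M]
    {N : Type*} [TopologicalSpace N] [ChartedSpace (EuclideanSpace ℝ (Fin (n + p))) N]
    [IsManifold (𝓡 (n + p)) ∞ N]
    (g : Casorati.Metric n M) (gN : Casorati.Metric (n + p) N)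
    (hN : Casorati.IsRealSpaceForm gN c)
    (φ : M → N) (hφ : Casorati.IsIsometricImmersion g gN φ) :
    (∀ x : M, Casorati.normalizedScalarCurvature g x ≤ Casorati.deltaHat g gN φ x + c) ∧
    (∀ x : M, Casorati.normalizedScalarCurvature g x = Casorati.deltaHat g gN φ x + c ↔
      Casorati.InvariantlyQuasiUmbilicalAt p g gN φ x ∧
      Casorati.NormalFlatAt (n := n) gN φ x ∧
      Casorati.IdealShapeAt p g gN φ x) ∧
    ((∀ x : M, Casorati.normalizedScalarCurvature g x = Casorati.deltaHat g gN φ x + c) ↔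
      Casorati.InvariantlyQuasiUmbilical p g gN φ ∧
      Casorati.TrivialNormalConnection (n := n) gN φ ∧
      ∀ x : M, Casorati.IdealShapeAt p g gN φ x) := by
  have hpt := fun x => theorem1p1_general n p hn c g gN φ hφ x (hN (φ x))
  refine ⟨fun x => (hpt x).1, fun x => (hpt x).2, ?_⟩
  simp only [(hpt _).2, forall_and]
  rfl
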